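/- Let $X,Y$ be Banach spaces over $\mathbb K\in\{\mathbb R,\mathbb C\}$, let $B_{X^*}$ be the closed unit ball of the dual of $X$, let $\mathcal L(X,Y)$ be the space of bounded linear operators from $X$ to $Y$, and let $0\le\sigma<1$. **Operator classes.** For $p,q\in[1,\infty)$, $\Pi_{q,p}(X,Y)$ is the set of those $u\in\mathcal L(X,Y)$ for which there is $C>0$ with $$\Big(\sum_{i=1}^n\|u(x_i)\|^q\Big)^{1/q}\le C\sup_{x'\in B_{X^*}}\Big(\sum_{i=1}^n|\langle x_i,x'\rangle|^p\Big)^{1/p}$$ for all finite sequences $x_1,\dots,x_n\in X$, and $\Pi_s:=\Pi_{s,s}$. For $1\le p\le q<\infty$, $\Pi^\sigma_{q,p}(X,Y)$ is the set of those $u\in\mathcal L(X,Y)$ for which there is $C>0$ with $$\Big(\sum_{i=1}^n\|u(x_i)\|^{\frac q{1-\sigma}}\Big)^{\frac{1-\sigma}q}\le C\sup_{x'\in B_{X^*}}\Big(\sum_{i=1}^n\big(|\langle x_i,x'\rangle|^{1-\sigma}\|x_i\|^\sigma\big)^{\frac p{1-\sigma}}\Big)^{\frac{1-\sigma}p}$$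 for all finite sequences $x_1,\dots,x_n\in X$, and $\Pi_p^\sigma:=\Pi_{p,p}^\sigma$. **Function spaces.** Let $\mu$ be a finite measure on a measurable space $\Omega$ and $1\le p<\infty$. For a simple function $f:\Omega\to X$ put $$\Phi_{p,\sigma}(f)=\sup_{x'\in B_{X^*}}\Big(\int\big(|\langle f,x'\rangle|^{1-\sigma}\|f\|^\sigma\big)^p\,d\mu\Big)^{1/p},\qquad \|f\|_{p,\sigma}=\inf\Big\{\sum_{i=1}^m\Phi_{p,\sigma}(f_i):\ f=\sum_{i=1}^m f_i,\ f_i\text{ simple}\Big\},$$ and let $\overline{\mathcal S_p^\sigma(\mu,X)}$ be the completion of the space of (classes of) $X$-valued simple functions for $\|\cdot\|_{p,\sigma}$. Let $\mathcal P_p(\mu,X)$ be the space of strongly measurable, Pettis integrable $f:\Omega\to X$ with $\langle f,x'\rangle\in L^p(\mu)$ for all $x'\in X^*$, with the norm $\sup_{x'\in B_{X^*}}\|\langle f,x'\rangle\|_{L^p(\mu)}$. This norm is at most $\|\cdot\|_{p,\sigma}$ on simple functions, so the inclusion of the simple functions into $\mathcal P_p(\mu,X)$ extends to a continuous map from $\overline{\mathcal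 S_p^\sigma(\mu,X)}$ to the completion of $\mathcal P_p(\mu,X)$; an element is *represented by* $f\in\mathcal P_p(\mu,X)$ if this map sends it to $f$. Let $\mathcal P_p^\sigma(\mu,X)$ be the subspace of those elements of $\overline{\mathcal S_p^\sigma(\mu,X)}$ that are represented by a function in $\mathcal P_p(\mu,X)$. Let $\mathcal B_p(\mu,Y)=L^p(\mu,Y)$ be the space of $p$-Bochner integrable functions. For $u\in\mathcal L(X,Y)$ consider the composition map $$\tilde u:\mathcal P^\sigma_{1/(1-\sigma)}(\mu,X)\to\mathcal B_{1/(1-\sigma)}(\mu,Y),$$ which sends an element represented by $f$ to $u\circ f$; "$\tilde u$ is continuous" means that it is well defined, with values in $\mathcal B_{1/(1-\sigma)}(\mu,Y)$, and continuous. **Corollary.** Let $0\le\sigma<1$ and let $\mu$ be a non-atomic finite measure (every measurable set of positive measure has a measurable subset of positive, strictly smaller measure). (i) If $\mu\neq0$, $u\in\mathcal L(X,Y)$ and $\tilde u$ is continuous, then $u\in\Pi^\sigma_{q,p}(X,Y)$ for all $1\le p\le q<\infty$. (ii) If $\Pi_{\frac1{1-\sigma},1}(X,Y)=\Pi_1^\sigma(X,Y)$,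 then $\Pi_{\frac1{1-\sigma},1}(X,Y)\subset\Pi^\sigma_{q,p}(X,Y)$ for all $1\le p\le q<\infty$. In particular, for every compact Hausdorff space $K$, $\Pi_{\frac1{1-\sigma},1}(C(K),Y)\subset\Pi^\sigma_{q,p}(C(K),Y)$ for all $1\le p\le q<\infty$. (iii) If $1\le s\le\frac1{1-\sigma}$ and $\mathcal L(X,Y)=\Pi_s(X,Y)$, then $\tilde u$ is continuous for every $u\in\mathcal L(X,Y)$, and $\mathcal L(X,Y)=\Pi_{q,p}^\sigma(X,Y)$ for all $1\le p\le q<\infty$. For instance, if $X=L^\infty(\nu)$ or $X=L^1(\nu)$ for a measure $\nu$, $Y$ is a Hilbert space and $\sigma\ge\frac12$, then $\mathcal L(X,Y)=\Pi_2(X,Y)$, $\tilde u$ is continuous for every $u\in\mathcal L(X,Y)$, and $\mathcal L(X,Y)=\Pi^\sigma_{q,p}(X,Y)$ for all $1\le p\le q<\infty$. -/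

import Mathlib

open MeasureTheory Filter Topology
open scoped ENNReal

noncomputable section

namespace AbsContOp

/-! ### Operator classes -/

section Operators

variable (𝕜 : Type*) [RCLike 𝕜]
variable (X Y : Type*) [NormedAddCommGroup X] [NormedSpace 𝕜 X]
  [NormedAddCommGroup Y] [NormedSpace 𝕜 Y]

/-- The closed unit ball of the dual space of `X`. -/
abbrev DualBall : Type _ := {φ : StrongDual 𝕜 X // ‖φ‖ ≤ 1}

/-- The class `Π_{q,p}(X,Y)` of `(q,p)`-summing operators.  The supremum is one of a bounded
family, because it runs over the dual unit ball for a fixed finite sequence. -/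
def summing (q p : ℝ) : Set (X →L[𝕜] Y) :=
  {u | ∃ C : ℝ, 0 < C ∧ ∀ (n : ℕ) (x : Fin n → X),
    (∑ i, ‖u (x i)‖ ^ q) ^ (1 / q) ≤
      C * ⨆ φ : DualBall 𝕜 X, (∑ i, ‖φ.1 (x i)‖ ^ p) ^ (1 / p)}

/-- The class `Π^σ_{q,p}(X,Y)` of `(q,p,σ)`-absolutely continuous operators. -/
def absCont (σ q p : ℝ) : Set (X →L[𝕜] Y) :=
  {u | ∃ C : ℝ, 0 < C ∧ ∀ (n : ℕ) (x : Fin n → X),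
    (∑ i, ‖u (x i)‖ ^ (q / (1 - σ))) ^ ((1 - σ) / q) ≤
      C * ⨆ φ : DualBall 𝕜 X,
        (∑ i, (‖φ.1 (x i)‖ ^ (1 - σ) * ‖x i‖ ^ σ) ^ (p / (1 - σ))) ^ ((1 - σ) / p)}

/-- The class `Π^σ_p(X,Y)` of `(p,σ)`-absolutely continuous operators. -/
def absCont₁ (σ p : ℝ) : Set (X →L[𝕜] Y) :=
  {u | ∃ C : ℝ, 0 < C ∧ ∀ (n : ℕ) (x : Fin n → X),
    (∑ i, ‖u (x i)‖ ^ (p / (1 - σ))) ^ ((1 - σ) / p) ≤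
      C * ⨆ φ : DualBall 𝕜 X,
        (∑ i, (‖φ.1 (x i)‖ ^ (1 - σ) * ‖x i‖ ^ σ) ^ (p / (1 - σ))) ^ ((1 - σ) / p)}

end Operators

/-! ### Function spaces -/

section Functions

variable {Ω : Type*} [MeasurableSpace Ω]

/-- A measure is non-atomic if every measurable set of positive measure has a measurable subset
of strictly smaller positive measure.  (Mathlib's `NoAtoms` only says that points are null.) -/
def NonAtomic (μ : Measure Ω) : Prop :=
  ∀ A, MeasurableSet A → 0 < μ A → ∃ B, MeasurableSet B ∧ B ⊆ A ∧ 0 < μ B ∧ μ B < μ A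

variable (𝕜 : Type*) [RCLike 𝕜] {X : Type*} [NormedAddCommGroup X] [NormedSpace 𝕜 X]

/-- `Φ_{p,σ}(f) = sup_φ (∫ (|⟨f, φ⟩|^{1-σ} ‖f‖^σ)^p dμ)^{1/p}`, over the dual unit ball. -/
def Phi (p σ : ℝ) (μ : Measure Ω) (f : SimpleFunc Ω X) : ℝ :=
  ⨆ φ : DualBall 𝕜 X, (∫ ω, (‖φ.1 (f ω)‖ ^ (1 - σ) * ‖f ω‖ ^ σ) ^ p ∂μ) ^ (1 / p)

/-- The convexification of `Φ_{p,σ}`. -/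
def convPhi (p σ : ℝ) (μ : Measure Ω) (f : SimpleFunc Ω X) : ℝ :=
  sInf {r | ∃ l : List (SimpleFunc Ω X), l.sum = f ∧ r = (l.map (Phi 𝕜 p σ μ)).sum}

variable {𝕜}

theorem Phi_nonneg (p σ : ℝ) (μ : Measure Ω) (f : SimpleFunc Ω X) : 0 ≤ Phi 𝕜 p σ μ f :=
  Real.iSup_nonneg fun _ => Real.rpow_nonneg (integral_nonneg fun _ => by positivity) _

theorem Phi_neg (p σ : ℝ) (μ : Measure Ω) (f : SimpleFunc Ω X) :
    Phi 𝕜 p σ μ (-f) = Phi 𝕜 p σ μ f := by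
  simp [Phi]

theorem sum_Phi_nonneg (p σ : ℝ) (μ : Measure Ω) (l : List (SimpleFunc Ω X)) :
    0 ≤ (l.map (Phi 𝕜 p σ μ)).sum :=
  List.sum_nonneg fun _ h => by
    obtain ⟨f, -, rfl⟩ := List.mem_map.1 h
    exact Phi_nonneg p σ μ f

theorem convPhi_le (p σ : ℝ) (μ : Measure Ω) (l : List (SimpleFunc Ω X)) :
    convPhi 𝕜 p σ μ l.sum ≤ (l.map (Phi 𝕜 p σ μ)).sum :=
  csInf_le ⟨0, by rintro _ ⟨m, -, rfl⟩; exact sum_Phi_nonneg (𝕜 := 𝕜) p σ μ m⟩ ⟨l, rfl, rfl⟩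

theorem le_convPhi (p σ : ℝ) (μ : Measure Ω) (f : SimpleFunc Ω X) (a : ℝ)
    (h : ∀ l : List (SimpleFunc Ω X), l.sum = f → a ≤ (l.map (Phi 𝕜 p σ μ)).sum) :
    a ≤ convPhi 𝕜 p σ μ f :=
  le_csInf ⟨_, [f], by simp, rfl⟩ (by rintro _ ⟨l, hl, rfl⟩; exact h l hl)

theorem convPhi_zero (p σ : ℝ) (μ : Measure Ω) :
    convPhi 𝕜 p σ μ (0 : SimpleFunc Ω X) = 0 :=
  le_antisymm (by simpa using convPhi_le (𝕜 := 𝕜) (X := X) p σ μ [])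
    (le_convPhi p σ μ _ _ fun l _ => sum_Phi_nonneg (𝕜 := 𝕜) p σ μ l)

theorem convPhi_add_le (p σ : ℝ) (μ : Measure Ω) (f g : SimpleFunc Ω X) :
    convPhi 𝕜 p σ μ (f + g) ≤ convPhi 𝕜 p σ μ f + convPhi 𝕜 p σ μ g := by
  rw [← sub_le_iff_le_add]
  refine le_convPhi (𝕜 := 𝕜) p σ μ f _ fun l hl => ?_
  rw [sub_le_comm]
  refine le_convPhi (𝕜 := 𝕜) p σ μ g _ fun m hm => ?_
  have := convPhi_le (𝕜 := 𝕜) p σ μ (l ++ m)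
  rw [List.sum_append, hl, hm, List.map_append, List.sum_append] at this
  linarith

theorem convPhi_neg_le (p σ : ℝ) (μ : Measure Ω) (f : SimpleFunc Ω X) :
    convPhi 𝕜 p σ μ (-f) ≤ convPhi 𝕜 p σ μ f := by
  refine le_convPhi (𝕜 := 𝕜) p σ μ f _ fun l hl => ?_
  have h1 : (l.map fun g => -g).sum = -f := by
    rw [← hl]
    clear hl
    induction l with
    | nil => simp
    | cons a l ih => rw [List.map_cons, List.sum_cons, List.sum_cons, ih, neg_add]
  have := convPhi_le (𝕜 := 𝕜) p σ μ (l.map fun g => -g)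
  rw [h1, List.map_map] at this
  refine this.trans (le_of_eq ?_)
  congr 1
  exact List.map_congr_left fun g _ => Phi_neg p σ μ g

theorem convPhi_neg (p σ : ℝ) (μ : Measure Ω) (f : SimpleFunc Ω X) :
    convPhi 𝕜 p σ μ (-f) = convPhi 𝕜 p σ μ f := by
  refine le_antisymm (convPhi_neg_le p σ μ f) ?_
  have h := convPhi_neg_le (𝕜 := 𝕜) p σ μ (-f)
  rwa [neg_neg] at h

variable (𝕜)

/-- The space `S_p^σ(μ,X)` of simple functions, with the seminorm `‖·‖_{p,σ}`.  Functions that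
agree almost everywhere are at distance `0`, so they are identified in the completion. -/
def SimpleSpace (_ : Type*) {Ω : Type*} [MeasurableSpace Ω] (_p _σ : ℝ) (_μ : Measure Ω)
    (X : Type*) : Type _ := SimpleFunc Ω X

instance (p σ : ℝ) (μ : Measure Ω) : AddCommGroup (SimpleSpace 𝕜 p σ μ X) :=
  inferInstanceAs (AddCommGroup (SimpleFunc Ω X))

/-- The convexification of `Φ_{p,σ}` is a seminorm. -/
def simpleSeminorm (p σ : ℝ) (μ : Measure Ω) : AddGroupSeminorm (SimpleSpace 𝕜 p σ μ X) where
  toFun f := convPhi (X := X) 𝕜 p σ μ f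
  map_zero' := convPhi_zero p σ μ
  add_le' f g := convPhi_add_le p σ μ f g
  neg' f := convPhi_neg p σ μ f

instance (p σ : ℝ) (μ : Measure Ω) : SeminormedAddCommGroup (SimpleSpace 𝕜 p σ μ X) :=
  (simpleSeminorm 𝕜 p σ μ).toSeminormedAddCommGroup

/-- The completion of `S_p^σ(μ,X)`. -/
abbrev SimpleCompletion {Ω : Type*} [MeasurableSpace Ω] (p σ : ℝ) (μ : Measure Ω)
    (X : Type*) [NormedAddCommGroup X] [NormedSpace 𝕜 X] : Type _ :=
  UniformSpace.Completion (SimpleSpace 𝕜 p σ μ X)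

/-- `f` belongs to `P_p(μ,X)`: it is strongly measurable, all `⟨f, φ⟩` are in `L^p(μ)`, and `f` has
a Pettis integral over every measurable set. -/
structure MemPettis (p : ℝ) (μ : Measure Ω) (f : Ω → X) : Prop where
  aestronglyMeasurable : AEStronglyMeasurable f μ
  memLp : ∀ φ : StrongDual 𝕜 X, MemLp (fun ω => φ (f ω)) (ENNReal.ofReal p) μ
  exists_integral : ∀ A, MeasurableSet A →
    ∃ x : X, ∀ φ : StrongDual 𝕜 X, ∫ ω in A, φ (f ω) ∂μ = φ x

/-- The `p`-Pettis norm `sup_φ ‖⟨f, φ⟩‖_{L^p(μ)}`, over the dual unit ball. -/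
def pettisNorm (p : ℝ) (μ : Measure Ω) (f : Ω → X) : ℝ≥0∞ :=
  ⨆ φ : DualBall 𝕜 X, eLpNorm (fun ω => φ.1 (f ω)) (ENNReal.ofReal p) μ

/-- The element `ξ` of the completion of `S_p^σ(μ,X)` is represented by the function `f` of
`P_p(μ,X)`.  Since the `p`-Pettis norm is dominated by `‖·‖_{p,σ}`, the inclusion of the simple
functions into the space `P_p(μ,X)` extends to a continuous map from the completion of
`S_p^σ(μ,X)` into the completion of `P_p(μ,X)`; the condition says that it sends `ξ` to `f`. -/
def Represents (p σ : ℝ) (μ : Measure Ω) (ξ : SimpleCompletion 𝕜 p σ μ X) (f : Ω → X) : Prop :=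
  MemPettis 𝕜 p μ f ∧
    ∃ s : ℕ → SimpleFunc Ω X,
      Tendsto (fun n => ((show SimpleSpace 𝕜 p σ μ X from s n : SimpleSpace 𝕜 p σ μ X) :
        SimpleCompletion 𝕜 p σ μ X)) atTop (𝓝 ξ) ∧
      Tendsto (fun n => pettisNorm 𝕜 p μ (fun ω => s n ω - f ω)) atTop (𝓝 0)

/-- The space `P_p^σ(μ,X)`: the elements of the completion of `S_p^σ(μ,X)` that are represented by
a function of `P_p(μ,X)`, with the topology of the completion. -/
def PettisSpace {Ω : Type*} [MeasurableSpace Ω] (p σ : ℝ) (μ : Measure Ω)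
    (X : Type*) [NormedAddCommGroup X] [NormedSpace 𝕜 X] : Set (SimpleCompletion 𝕜 p σ μ X) :=
  {ξ | ∃ f : Ω → X, Represents 𝕜 p σ μ ξ f}

variable {𝕜}

/-- The composition operator `ũ : P_p^σ(μ,X) → B_p(μ,Y)`, `ũ(f) = u ∘ f`, is well defined and
continuous.  Here `B_p(μ,Y)` is the space `L^p(μ,Y)` of `p`-Bochner integrable functions, with
its norm. -/
def CompContinuous {Y : Type*} [NormedAddCommGroup Y] [NormedSpace 𝕜 Y]
    (p σ : ℝ) (μ : Measure Ω) (u : X →L[𝕜] Y) : Prop :=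
  ∃ T : PettisSpace 𝕜 p σ μ X → Lp Y (ENNReal.ofReal p) μ,
    (∀ (ξ : PettisSpace 𝕜 p σ μ X) (f : Ω → X), Represents 𝕜 p σ μ ξ.1 f →
      (T ξ : Ω → Y) =ᵐ[μ] fun ω => u (f ω)) ∧
    ∀ ξ, Tendsto (fun η => ‖T η - T ξ‖) (𝓝 ξ) (𝓝 0)

end Functions

end AbsContOp

end

/-! With `r = 1 / (1 - σ)`, everything passes through one inequality, `DominatedWith r D u`: `∑ ‖u
xᵢ‖^r ≤ D · sup_φ ∑ |φ xᵢ| ‖xᵢ‖^(r-1)`. Both sides are `r`-homogeneous in each `xᵢ`, so nonnegative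
weights can be inserted freely (`DominatedWith.weighted`). Two consequences follow. Weights `‖u
xᵢ‖^(r(p-1))` and Young's inequality raise the exponent from `1` to `p`, without a Pietsch measure,
and monotonicity of `ℓ^p` norms then gives every `q ≥ p` (`DominatedWith.mem_absCont`). Weights
equal to the measures of level sets turn sums into integrals of simple functions and make `ũ`
bounded (`DominatedWith.compContinuous`).

It remains to obtain the inequality. From continuity of `ũ`, place a finite family on disjoint sets
of positive measure, which non-atomicity supplies. From `Π_s` with `s ≤ r`, rescale by powers of
`‖xᵢ‖`. On `C(K)`, an `(r,1)`-summing operator is handled by a Pisier-type argument: a nearly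
extremal family for the summing inequality yields a bounded linear functional controlling `‖u c‖^r`
for `0 ≤ c ≤ 1`, and linearity sums these bounds.

For `L^∞` and `L^1` into a Hilbert space, the little Grothendieck theorem is proved on finite `ℓ^∞`
by random signs and truncation, with the remainder absorbed into the best constant. Simple functions
carry it to `L^∞`; a Hilbert–Schmidt transposition carries it to `L^1`. -/

noncomputable section

namespace AbsContOp

/-! ### The domination inequality and its consequences for the operator classes. -/

section Domination

variable {𝕜 : Type*} [RCLike 𝕜]
variable {X Y : Type*} [NormedAddCommGroup X] [NormedSpace 𝕜 X]
  [NormedAddCommGroup Y] [NormedSpace 𝕜 Y]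

/-- The `r`-th power form of the inequality that defines `Π^σ_1(X,Y)`, where `r = 1 / (1 - σ)`. -/
def DominatedWith (r D : ℝ) (u : X →L[𝕜] Y) : Prop :=
  ∀ (n : ℕ) (x : Fin n → X) (B : ℝ),
    (∀ φ : DualBall 𝕜 X, ∑ i, ‖φ.1 (x i)‖ * ‖x i‖ ^ (r - 1) ≤ B) → ∑ i, ‖u (x i)‖ ^ r ≤ D * B

theorem norm_apply_le_of_dualBall (φ : DualBall 𝕜 X) (x : X) : ‖φ.1 x‖ ≤ ‖x‖ :=
  (φ.1.le_of_opNorm_le φ.2 x).trans (one_mul _).le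

instance : Nonempty (DualBall 𝕜 X) := ⟨⟨0, by simp⟩⟩

theorem norm_ofReal_smul_rpow {Z : Type*} [NormedAddCommGroup Z] [NormedSpace 𝕜 Z] {r w : ℝ}
    (hr : r ≠ 0) (hw : 0 ≤ w) (z : Z) :
    ‖((w ^ (1 / r) : ℝ) : 𝕜) • z‖ ^ r = w * ‖z‖ ^ r := by
  have h := Real.rpow_nonneg hw (1 / r)
  rw [norm_smul, RCLike.norm_ofReal, abs_of_nonneg h, Real.mul_rpow h (norm_nonneg _),
    ← Real.rpow_mul hw, one_div, inv_mul_cancel₀ hr, Real.rpow_one]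

theorem mul_rpow_sub_one {r a : ℝ} (hr : r ≠ 0) (ha : 0 ≤ a) : a * a ^ (r - 1) = a ^ r := by
  rcases ha.eq_or_lt with rfl | ha
  · simp [Real.zero_rpow hr]
  · rw [Real.rpow_sub_one ha.ne']; field_simp

theorem norm_mul_norm_smul {r w : ℝ} (hr : r ≠ 0) (hw : 0 ≤ w) (φ : StrongDual 𝕜 X) (x : X) :
    ‖φ (((w ^ (1 / r) : ℝ) : 𝕜) • x)‖ * ‖((w ^ (1 / r) : ℝ) : 𝕜) • x‖ ^ (r - 1) =
      w * (‖φ x‖ * ‖x‖ ^ (r - 1)) := by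
  have h := Real.rpow_nonneg hw (1 / r)
  rw [map_smul, norm_smul, norm_smul, RCLike.norm_ofReal, abs_of_nonneg h,
    Real.mul_rpow h (norm_nonneg _), mul_mul_mul_comm, mul_rpow_sub_one hr h,
    ← Real.rpow_mul hw, one_div, inv_mul_cancel₀ hr, Real.rpow_one]

/-- Replacing `x i` by `w i ^ (1 / r) • x i` multiplies the `i`-th term on either side by `w i`. -/
theorem DominatedWith.weighted {r D : ℝ} {u : X →L[𝕜] Y} (h : DominatedWith r D u) (hr : r ≠ 0)
    {ι : Type*} (s : Finset ι) (w : ι → ℝ) (hw : ∀ i, 0 ≤ w i) (x : ι → X) (B : ℝ)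
    (hB : ∀ φ : DualBall 𝕜 X, ∑ i ∈ s, w i * (‖φ.1 (x i)‖ * ‖x i‖ ^ (r - 1)) ≤ B) :
    ∑ i ∈ s, w i * ‖u (x i)‖ ^ r ≤ D * B := by
  have e := s.equivFin
  have key := h s.card (fun i => ((w (e.symm i) ^ (1 / r) : ℝ) : 𝕜) • x (e.symm i)) B fun φ => by
    simp_rw [norm_mul_norm_smul hr (hw _)]
    rw [Equiv.sum_comp e.symm (fun i => w i * (‖φ.1 (x i)‖ * ‖x i‖ ^ (r - 1))),
      Finset.sum_coe_sort s (fun i => w i * (‖φ.1 (x i)‖ * ‖x i‖ ^ (r - 1)))]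
    exact hB φ
  simp_rw [map_smul, norm_ofReal_smul_rpow hr (hw _)] at key
  rwa [Equiv.sum_comp e.symm (fun i => w i * ‖u (x i)‖ ^ r),
    Finset.sum_coe_sort s (fun i => w i * ‖u (x i)‖ ^ r)] at key

/-- Convexity: the graph of `t ↦ t ^ p` lies above its tangent at `a`. This replaces Hölder's
inequality below and supplies the linearisation in the argument on `C(K)`. -/
theorem young_tangent {p a b : ℝ} (hp : 1 ≤ p) (ha : 0 ≤ a) (hb : 0 ≤ b) :
    p * (a ^ (p - 1) * b) ≤ (p - 1) * a ^ p + b ^ p := by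
  have hp0 : 0 < p := by linarith
  have h := Real.geom_mean_le_arith_mean2_weighted (w₁ := 1 - 1 / p) (w₂ := 1 / p)
    (p₁ := a ^ p) (p₂ := b ^ p) (by rw [sub_nonneg, div_le_one hp0]; exact hp) (by positivity)
    (by positivity) (by positivity) (by ring)
  rw [← Real.rpow_mul ha, ← Real.rpow_mul hb, mul_one_div_cancel hp0.ne', Real.rpow_one,
    show p * (1 - 1 / p) = p - 1 by field_simp] at h
  calc p * (a ^ (p - 1) * b) ≤ p * ((1 - 1 / p) * a ^ p + 1 / p * b ^ p) := by gcongr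
    _ = _ := by field_simp

theorem sum_rpow_rpow_anti {n : ℕ} {p q : ℝ} (hp : 0 < p) (hpq : p ≤ q) (a : Fin n → ℝ)
    (ha : ∀ i, 0 ≤ a i) : (∑ i, a i ^ q) ^ (1 / q) ≤ (∑ i, a i ^ p) ^ (1 / p) := by
  have hq : 0 < q := hp.trans_le hpq
  set A := ∑ i, a i ^ p with hA
  have hA0 : 0 ≤ A := Finset.sum_nonneg fun i _ => Real.rpow_nonneg (ha i) _
  have hle : ∀ i, a i ≤ A ^ (1 / p) := fun i => by
    have : a i ^ p ≤ A :=
      Finset.single_le_sum (fun i _ => Real.rpow_nonneg (ha i) p) (Finset.mem_univ i)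
    calc a i = (a i ^ p) ^ (1 / p) := by
          rw [← Real.rpow_mul (ha i), mul_one_div_cancel hp.ne', Real.rpow_one]
      _ ≤ _ := by gcongr; exact Real.rpow_nonneg (ha i) _
  have : ∑ i, a i ^ q ≤ (A ^ (1 / p)) ^ q := by
    calc ∑ i, a i ^ q ≤ ∑ i, a i ^ p * (A ^ (1 / p)) ^ (q - p) := by
          refine Finset.sum_le_sum fun i _ => ?_
          rw [show q = p + (q - p) by ring,
            Real.rpow_add_of_nonneg (ha i) hp.le (by linarith), add_sub_cancel_left]
          have := hle i
          have h1 := ha i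
          gcongr
      _ = A * (A ^ (1 / p)) ^ (q - p) := by rw [← Finset.sum_mul]
      _ = (A ^ (1 / p)) ^ p * (A ^ (1 / p)) ^ (q - p) := by
          rw [← Real.rpow_mul hA0 (1 / p) p, one_div_mul_cancel hp.ne', Real.rpow_one]
      _ = _ := by
          rw [← Real.rpow_add_of_nonneg (by positivity) hp.le (by linarith), add_sub_cancel]
  calc (∑ i, a i ^ q) ^ (1 / q) ≤ ((A ^ (1 / p)) ^ q) ^ (1 / q) := by
        gcongr
        exact Finset.sum_nonneg fun i _ => Real.rpow_nonneg (ha i) _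
    _ = _ := by rw [← Real.rpow_mul (by positivity), mul_one_div_cancel hq.ne', Real.rpow_one]

theorem bddAbove_range_sum {n : ℕ} {e : ℝ} (he : 0 ≤ e) (g : DualBall 𝕜 X → Fin n → ℝ)
    (b : Fin n → ℝ) (hg : ∀ φ i, 0 ≤ g φ i) (hb : ∀ φ i, g φ i ≤ b i) :
    BddAbove (Set.range fun φ : DualBall 𝕜 X => (∑ i, g φ i) ^ e) := by
  refine ⟨(∑ i, b i) ^ e, ?_⟩
  rintro _ ⟨φ, rfl⟩
  exact Real.rpow_le_rpow (Finset.sum_nonneg fun i _ => hg φ i)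
    (Finset.sum_le_sum fun i _ => hb φ i) he

variable {σ : ℝ}

theorem interpolation_rpow (hσ : σ < 1) {p a b : ℝ} (ha : 0 ≤ a) (hb : 0 ≤ b) :
    (a ^ (1 - σ) * b ^ σ) ^ (p / (1 - σ)) = (a * b ^ (1 / (1 - σ) - 1)) ^ p := by
  have : 0 < 1 - σ := by linarith
  rw [Real.mul_rpow (by positivity) (by positivity), Real.mul_rpow ha (by positivity),
    ← Real.rpow_mul ha, ← Real.rpow_mul hb, ← Real.rpow_mul hb]
  congr 2 <;> field_simp
  ring

theorem bddAbove_range_interpolation (hσ : σ < 1) {p : ℝ} (hp : 1 ≤ p) {n : ℕ}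
    (x : Fin n → X) :
    BddAbove (Set.range fun φ : DualBall 𝕜 X =>
      (∑ i, (‖φ.1 (x i)‖ ^ (1 - σ) * ‖x i‖ ^ σ) ^ (p / (1 - σ))) ^ ((1 - σ) / p)) := by
  have h1 : 0 < 1 - σ := by linarith
  refine bddAbove_range_sum (by positivity) _
    (fun i => (‖x i‖ ^ (1 - σ) * ‖x i‖ ^ σ) ^ (p / (1 - σ))) (fun _ _ => by positivity)
    fun φ i => ?_
  have := norm_apply_le_of_dualBall φ (x i)
  gcongr

theorem exists_dominatedWith_of_mem_absCont₁ (hσ : σ < 1) {u : X →L[𝕜] Y}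
    (hu : u ∈ absCont₁ 𝕜 X Y σ 1) : ∃ D, 0 ≤ D ∧ DominatedWith (1 / (1 - σ)) D u := by
  have h1 : 0 < 1 - σ := by linarith
  obtain ⟨C, hC, h⟩ := hu
  refine ⟨C ^ (1 / (1 - σ)), by positivity, fun n x B hB => ?_⟩
  have hB0 : 0 ≤ B := (Finset.sum_nonneg fun i _ => by positivity).trans (hB ⟨0, by simp⟩)
  have h2 : (∑ i, ‖u (x i)‖ ^ (1 / (1 - σ))) ^ (1 - σ) ≤ C * B ^ (1 - σ) := by
    have := h n x
    rw [div_one] at this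
    refine this.trans ?_
    gcongr
    refine ciSup_le fun φ => ?_
    gcongr
    simp_rw [interpolation_rpow hσ (norm_nonneg _) (norm_nonneg _), Real.rpow_one]
    exact hB φ
  have h3 := Real.rpow_le_rpow (by positivity) h2 (z := 1 / (1 - σ)) (by positivity)
  rwa [Real.mul_rpow hC.le (by positivity), ← Real.rpow_mul (by positivity), ← Real.rpow_mul hB0,
    mul_one_div_cancel h1.ne', Real.rpow_one, Real.rpow_one] at h3

/-- With `aᵢ = ‖u xᵢ‖^r` and weights `aᵢ^(p-1)`, the left side becomes `A = ∑ aᵢ^p`. Young's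
inequality on the right gives `p A ≤ (p - 1) A + D^p W^(p/(1-σ))`, and the term in `A` is absorbed.
-/
theorem DominatedWith.mem_absCont (hσ : σ < 1) {u : X →L[𝕜] Y} {D : ℝ}
    (hD : 0 ≤ D) (hu : DominatedWith (1 / (1 - σ)) D u) {p q : ℝ} (hp : 1 ≤ p) (hpq : p ≤ q) :
    u ∈ absCont 𝕜 X Y σ q p := by
  have h1 : 0 < 1 - σ := by linarith
  have hp0 : 0 < p := by linarith
  set r := 1 / (1 - σ) with hr
  have hr0 : 0 < r := by positivity
  -- The added `1` only makes the constant strictly positive when `D = 0`.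
  refine ⟨D ^ (1 - σ) + 1, by positivity, fun n x => ?_⟩
  set W := ⨆ φ : DualBall 𝕜 X,
    (∑ i, (‖φ.1 (x i)‖ ^ (1 - σ) * ‖x i‖ ^ σ) ^ (p / (1 - σ))) ^ ((1 - σ) / p) with hW
  have hW0 : 0 ≤ W := Real.iSup_nonneg fun φ => by positivity
  set a : Fin n → ℝ := fun i => ‖u (x i)‖ ^ r with ha
  have ha0 : ∀ i, 0 ≤ a i := fun i => by positivity
  set A := ∑ i, a i ^ p with hA
  have hA0 : 0 ≤ A := Finset.sum_nonneg fun i _ => by have := ha0 i; positivity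
  have hφ : ∀ φ : DualBall 𝕜 X, ∑ i, (‖φ.1 (x i)‖ * ‖x i‖ ^ (r - 1)) ^ p ≤ W ^ (p / (1 - σ)) := by
    intro φ
    have h2 := le_ciSup (bddAbove_range_interpolation (𝕜 := 𝕜) hσ hp x) φ
    have h3 := Real.rpow_le_rpow (by positivity) h2 (z := p / (1 - σ)) (by positivity)
    rw [← Real.rpow_mul (by positivity), show (1 - σ) / p * (p / (1 - σ)) = 1 by field_simp,
      Real.rpow_one] at h3
    simp_rw [hr, ← interpolation_rpow hσ (norm_nonneg _) (norm_nonneg _)]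
    exact h3
  have h4 : p * A ≤ (p - 1) * A + D ^ p * W ^ (p / (1 - σ)) := by
    -- The main case divides by `p * D`; for `D = 0` any finite bound on the weak sums forces `A =
    -- 0`.
    rcases hD.eq_or_lt with hD' | hD'
    · have h5 := hu.weighted hr0.ne' Finset.univ (fun i => a i ^ (p - 1))
        (fun i => Real.rpow_nonneg (ha0 i) _) x _ (fun φ => Finset.sum_le_sum fun i _ =>
          mul_le_mul_of_nonneg_left (mul_le_mul_of_nonneg_right
            (norm_apply_le_of_dualBall φ (x i)) (by positivity)) (Real.rpow_nonneg (ha0 i) _))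
      rw [← hD', zero_mul] at h5
      have : A ≤ 0 := by
        refine le_trans (le_of_eq (Finset.sum_congr rfl fun i _ => ?_)) h5
        rw [mul_comm]; exact (mul_rpow_sub_one hp0.ne' (ha0 i)).symm
      have : A = 0 := le_antisymm this hA0
      rw [this, ← hD']; simp; positivity
    · have h5 := hu.weighted hr0.ne' Finset.univ (fun i => a i ^ (p - 1))
        (fun i => Real.rpow_nonneg (ha0 i) _) x
        (((p - 1) * A + D ^ p * W ^ (p / (1 - σ))) / (p * D)) (fun φ => by
          rw [le_div_iff₀ (by positivity), Finset.sum_mul]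
          calc _ ≤ ∑ i, ((p - 1) * a i ^ p + (D * (‖φ.1 (x i)‖ * ‖x i‖ ^ (r - 1))) ^ p) := by
                refine Finset.sum_le_sum fun i _ => le_trans (le_of_eq ?_)
                  (young_tangent hp (ha0 i) (b := D * (‖φ.1 (x i)‖ * ‖x i‖ ^ (r - 1)))
                    (by positivity))
                ring
            _ = (p - 1) * A + D ^ p * ∑ i, (‖φ.1 (x i)‖ * ‖x i‖ ^ (r - 1)) ^ p := by
                rw [Finset.sum_add_distrib, ← Finset.mul_sum]
                congr 1
                rw [Finset.mul_sum]
                exact Finset.sum_congr rfl fun i _ =>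
                  Real.mul_rpow hD (mul_nonneg (norm_nonneg _) (by positivity))
            _ ≤ _ := by gcongr; exact hφ φ)
      have h6 : ∑ i, a i ^ (p - 1) * ‖u (x i)‖ ^ r = A := Finset.sum_congr rfl fun i _ => by
        rw [mul_comm]; exact mul_rpow_sub_one hp0.ne' (ha0 i)
      rw [h6] at h5
      calc p * A ≤ p * (D * (((p - 1) * A + D ^ p * W ^ (p / (1 - σ))) / (p * D))) := by gcongr
        _ = _ := by field_simp
  have h7 : A ≤ D ^ p * W ^ (p / (1 - σ)) := by linarith
  calc (∑ i, ‖u (x i)‖ ^ (q / (1 - σ))) ^ ((1 - σ) / q)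
      = (∑ i, ‖u (x i)‖ ^ (q / (1 - σ))) ^ (1 / (q / (1 - σ))) := by rw [one_div_div]
    _ ≤ (∑ i, ‖u (x i)‖ ^ (p / (1 - σ))) ^ (1 / (p / (1 - σ))) :=
        sum_rpow_rpow_anti (by positivity) (by gcongr) _ fun i => norm_nonneg _
    _ = A ^ ((1 - σ) / p) := by
        rw [one_div_div]
        congr 1
        refine Finset.sum_congr rfl fun i _ => ?_
        rw [ha, ← Real.rpow_mul (norm_nonneg _), hr]; congr 1; ring
    _ ≤ (D ^ p * W ^ (p / (1 - σ))) ^ ((1 - σ) / p) := by gcongr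
    _ = D ^ (1 - σ) * W := by
        rw [Real.mul_rpow (by positivity) (by positivity), ← Real.rpow_mul hD,
          ← Real.rpow_mul hW0, show p / (1 - σ) * ((1 - σ) / p) = 1 by field_simp,
          show p * ((1 - σ) / p) = 1 - σ by field_simp, Real.rpow_one]
    _ ≤ (D ^ (1 - σ) + 1) * W := by gcongr; linarith

/-- Apply the `s`-summing inequality to `‖xᵢ‖^((r-s)/s) • xᵢ`. On the weak side `|φ xᵢ|^(s-1) ≤
‖xᵢ‖^(s-1)`; on the other side `‖u xᵢ‖^(r-s)` is bounded by the operator norm. -/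
theorem exists_dominatedWith_of_mem_summing {s r : ℝ} (hs : 1 ≤ s) (hsr : s ≤ r) {u : X →L[𝕜] Y}
    (hu : u ∈ summing 𝕜 X Y s s) : ∃ D, 0 ≤ D ∧ DominatedWith r D u := by
  obtain ⟨C, hC, h⟩ := hu
  have hs0 : 0 < s := by linarith
  refine ⟨‖u‖ ^ (r - s) * C ^ s, by positivity, fun n x B hB => ?_⟩
  have hB0 : 0 ≤ B := (Finset.sum_nonneg fun i _ => by positivity).trans (hB ⟨0, by simp⟩)
  have h1 := h n fun i => (((‖x i‖ ^ (r - s)) ^ (1 / s) : ℝ) : 𝕜) • x i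
  simp_rw [map_smul, norm_ofReal_smul_rpow hs0.ne' (Real.rpow_nonneg (norm_nonneg _) _)] at h1
  have h2 : (∑ i, ‖x i‖ ^ (r - s) * ‖u (x i)‖ ^ s) ^ (1 / s) ≤ C * B ^ (1 / s) := by
    refine h1.trans ?_
    gcongr
    refine ciSup_le fun φ => ?_
    gcongr
    refine le_trans (Finset.sum_le_sum fun i _ => ?_) (hB φ)
    calc ‖x i‖ ^ (r - s) * ‖φ.1 (x i)‖ ^ s
        = ‖φ.1 (x i)‖ * (‖φ.1 (x i)‖ ^ (s - 1) * ‖x i‖ ^ (r - s)) := by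
          rw [← mul_rpow_sub_one hs0.ne' (norm_nonneg _)]; ring
      _ ≤ ‖φ.1 (x i)‖ * (‖x i‖ ^ (s - 1) * ‖x i‖ ^ (r - s)) := by
          have := norm_apply_le_of_dualBall φ (x i)
          gcongr
      _ = _ := by
          rw [← Real.rpow_add_of_nonneg (norm_nonneg _) (by linarith) (by linarith)]
          congr 2; ring
  have h3 := Real.rpow_le_rpow (by positivity) h2 (z := s) hs0.le
  rw [Real.mul_rpow hC.le (by positivity), ← Real.rpow_mul (by positivity), ← Real.rpow_mul hB0,
    one_div_mul_cancel hs0.ne', Real.rpow_one, Real.rpow_one] at h3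
  calc ∑ i, ‖u (x i)‖ ^ r ≤ ∑ i, ‖u‖ ^ (r - s) * (‖x i‖ ^ (r - s) * ‖u (x i)‖ ^ s) := by
        refine Finset.sum_le_sum fun i _ => ?_
        calc ‖u (x i)‖ ^ r = ‖u (x i)‖ ^ (r - s) * ‖u (x i)‖ ^ s := by
              rw [← Real.rpow_add_of_nonneg (norm_nonneg _) (by linarith) hs0.le, sub_add_cancel]
          _ ≤ (‖u‖ * ‖x i‖) ^ (r - s) * ‖u (x i)‖ ^ s := by
              have := u.le_opNorm (x i)
              gcongr
          _ = _ := by rw [Real.mul_rpow (norm_nonneg _) (norm_nonneg _), mul_assoc]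
    _ ≤ ‖u‖ ^ (r - s) * (C ^ s * B) := by rw [← Finset.mul_sum]; gcongr
    _ = _ := by ring

end Domination

end AbsContOp

namespace AbsContOp

/-! ### Continuity of the composition map from domination. -/

section Composition

variable {𝕜 : Type*} [RCLike 𝕜]
variable {X Y : Type*} [NormedAddCommGroup X] [NormedSpace 𝕜 X]
  [NormedAddCommGroup Y] [NormedSpace 𝕜 Y]
variable {Ω : Type*} [MeasurableSpace Ω] {μ : Measure Ω}

theorem integral_comp_simpleFunc [IsFiniteMeasure μ] {F : Type*} [NormedAddCommGroup F]
    [NormedSpace ℝ F] [CompleteSpace F] (f : SimpleFunc Ω X) (g : X → F) (hg : g 0 = 0) :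
    ∫ ω, g (f ω) ∂μ = ∑ c ∈ f.range, μ.real (f ⁻¹' {c}) • g c := by
  rw [← SimpleFunc.map_integral f g f.integrable_of_isFiniteMeasure hg,
    SimpleFunc.integral_eq_integral _ (f.map g).integrable_of_isFiniteMeasure]
  rfl

theorem exists_nnreal_eLpNorm_le_pettisNorm (p : ℝ) (ψ : StrongDual 𝕜 X) :
    ∃ c : NNReal, ∀ h : Ω → X,
      eLpNorm (fun ω => ψ (h ω)) (ENNReal.ofReal p) μ ≤ c * pettisNorm 𝕜 p μ h := by
  -- Dividing by `‖ψ‖ + 1` puts `ψ` in the unit ball and also covers `ψ = 0`.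
  set a : 𝕜 := ((‖ψ‖ + 1 : ℝ) : 𝕜) with ha
  have hn : ‖a‖ = ‖ψ‖ + 1 := by rw [ha, RCLike.norm_ofReal, abs_of_pos (by positivity)]
  have ha0 : a ≠ 0 := norm_ne_zero_iff.1 (by rw [hn]; positivity)
  refine ⟨‖a‖₊, fun h => ?_⟩
  have hφ : ‖a⁻¹ • ψ‖ ≤ 1 := by
    rw [norm_smul, norm_inv, hn, inv_mul_le_iff₀ (by positivity)]; linarith
  have h1 : (fun ω => ψ (h ω)) = a • fun ω => (a⁻¹ • ψ) (h ω) := by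
    ext ω; simp [ha0]
  rw [h1, eLpNorm_const_smul]
  exact mul_le_mul_right (le_iSup (fun φ : DualBall 𝕜 X =>
    eLpNorm (fun ω => φ.1 (h ω)) (ENNReal.ofReal p) μ) ⟨_, hφ⟩) _

theorem represents_coe [IsFiniteMeasure μ] (p σ : ℝ) (f : SimpleFunc Ω X) :
    Represents 𝕜 p σ μ ((show SimpleSpace 𝕜 p σ μ X from f : SimpleSpace 𝕜 p σ μ X) :
      SimpleCompletion 𝕜 p σ μ X) f := by
  refine ⟨⟨f.aestronglyMeasurable, fun φ => (f.map φ).memLp_of_isFiniteMeasure _ _,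
    fun A _ => ⟨∑ c ∈ f.range, (((μ.restrict A).real (f ⁻¹' {c}) : ℝ) : 𝕜) • c, fun φ => ?_⟩⟩,
    fun _ => f, tendsto_const_nhds, ?_⟩
  · rw [integral_comp_simpleFunc f φ (map_zero φ), map_sum]
    refine Finset.sum_congr rfl fun c _ => ?_
    rw [map_smul, RCLike.real_smul_eq_coe_mul, smul_eq_mul]
  · simp [pettisNorm]

variable {σ : ℝ}

theorem interpolation_rpow_one_div (hσ : σ < 1) {a b : ℝ} (ha : 0 ≤ a) (hb : 0 ≤ b) :
    (a ^ (1 - σ) * b ^ σ) ^ (1 / (1 - σ)) = a * b ^ (1 / (1 - σ) - 1) := by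
  rw [interpolation_rpow hσ ha hb, Real.rpow_one]

theorem Phi_eq (hσ : σ < 1) (f : SimpleFunc Ω X) :
    Phi 𝕜 (1 / (1 - σ)) σ μ f = ⨆ φ : DualBall 𝕜 X,
      (∫ ω, ‖φ.1 (f ω)‖ * ‖f ω‖ ^ (1 / (1 - σ) - 1) ∂μ) ^ (1 - σ) := by
  simp_rw [Phi, interpolation_rpow_one_div hσ (norm_nonneg _) (norm_nonneg _), one_div_one_div]

theorem integral_le_Phi_rpow [IsFiniteMeasure μ] (hσ : σ < 1) (f : SimpleFunc Ω X)
    (φ : DualBall 𝕜 X) :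
    ∫ ω, ‖φ.1 (f ω)‖ * ‖f ω‖ ^ (1 / (1 - σ) - 1) ∂μ ≤
      Phi 𝕜 (1 / (1 - σ)) σ μ f ^ (1 / (1 - σ)) := by
  have h1 : 0 < 1 - σ := by linarith
  have h0 : ∀ φ : DualBall 𝕜 X, 0 ≤ ∫ ω, ‖φ.1 (f ω)‖ * ‖f ω‖ ^ (1 / (1 - σ) - 1) ∂μ :=
    fun φ => integral_nonneg fun ω => by positivity
  have hb : BddAbove (Set.range fun φ : DualBall 𝕜 X =>
      (∫ ω, ‖φ.1 (f ω)‖ * ‖f ω‖ ^ (1 / (1 - σ) - 1) ∂μ) ^ (1 - σ)) := by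
    refine ⟨(∫ ω, ‖f ω‖ * ‖f ω‖ ^ (1 / (1 - σ) - 1) ∂μ) ^ (1 - σ), ?_⟩
    rintro _ ⟨φ, rfl⟩
    refine Real.rpow_le_rpow (h0 φ) (integral_mono
      (f.map fun x => ‖φ.1 x‖ * ‖x‖ ^ (1 / (1 - σ) - 1)).integrable_of_isFiniteMeasure
      (f.map fun x => ‖x‖ * ‖x‖ ^ (1 / (1 - σ) - 1)).integrable_of_isFiniteMeasure
      fun ω => ?_) h1.le
    exact mul_le_mul_of_nonneg_right (norm_apply_le_of_dualBall φ (f ω)) (by positivity)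
  have h2 := le_ciSup hb φ
  rw [← Phi_eq hσ] at h2
  have h3 := Real.rpow_le_rpow (by have := h0 φ; positivity) h2 (z := 1 / (1 - σ)) (by positivity)
  rwa [← Real.rpow_mul (h0 φ), mul_one_div_cancel h1.ne', Real.rpow_one] at h3

theorem norm_toLp_simpleFunc [IsFiniteMeasure μ] {r : ℝ} (hr : 0 < r) (g : SimpleFunc Ω Y) :
    ‖(g.memLp_of_isFiniteMeasure (ENNReal.ofReal r) μ).toLp g‖ =
      (∫ ω, ‖g ω‖ ^ r ∂μ) ^ (1 / r) := by
  have h0 : 0 ≤ ∫ ω, ‖g ω‖ ^ r ∂μ := integral_nonneg fun ω => by positivity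
  rw [Lp.norm_toLp, MemLp.eLpNorm_eq_integral_rpow_norm (by simpa using hr) ENNReal.ofReal_ne_top
    (g.memLp_of_isFiniteMeasure _ _), ENNReal.toReal_ofReal hr.le,
    ENNReal.toReal_ofReal (by positivity), one_div]

/-- Composition with `u`, from simple functions to `L^p`. -/
def simpleComp [IsFiniteMeasure μ] (p σ : ℝ) (u : X →L[𝕜] Y) :
    SimpleSpace 𝕜 p σ μ X →+ Lp Y (ENNReal.ofReal p) μ where
  toFun f := ((SimpleFunc.map u f).memLp_of_isFiniteMeasure (ENNReal.ofReal p) μ).toLp _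
  map_zero' := by
    apply Lp.ext
    filter_upwards [MemLp.coeFn_toLp ((SimpleFunc.map u (0 : SimpleFunc Ω X)).memLp_of_isFiniteMeasure
      (ENNReal.ofReal p) μ), Lp.coeFn_zero Y (ENNReal.ofReal p) μ] with ω h1 h2
    rw [h2]
    exact h1.trans (map_zero u)
  map_add' f g := by
    rw [← MemLp.toLp_add]
    congr 1
    ext ω
    exact map_add u _ _

/-- The integrals are finite sums over the values of `f`, so this is the weighted domination
inequality with the measures of the level sets as weights. -/
theorem DominatedWith.norm_simpleComp_le_Phi [IsFiniteMeasure μ] (hσ : σ < 1) {u : X →L[𝕜] Y}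
    {D : ℝ} (hD : 0 ≤ D) (hu : DominatedWith (1 / (1 - σ)) D u) (f : SimpleFunc Ω X) :
    ‖simpleComp (μ := μ) (1 / (1 - σ)) σ u f‖ ≤ D ^ (1 - σ) * Phi 𝕜 (1 / (1 - σ)) σ μ f := by
  have h1 : 0 < 1 - σ := by linarith
  have hr : 0 < 1 / (1 - σ) := by positivity
  have hΦ := Phi_nonneg (𝕜 := 𝕜) (1 / (1 - σ)) σ μ f
  refine (norm_toLp_simpleFunc hr (SimpleFunc.map u f)).trans_le ?_
  have key : ∫ ω, ‖u (f ω)‖ ^ (1 / (1 - σ)) ∂μ ≤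
      D * Phi 𝕜 (1 / (1 - σ)) σ μ f ^ (1 / (1 - σ)) := by
    rw [integral_comp_simpleFunc f (fun x => ‖u x‖ ^ (1 / (1 - σ)))
      (by simp only [map_zero, norm_zero]; exact Real.zero_rpow hr.ne')]
    refine hu.weighted hr.ne' f.range (fun c => μ.real (f ⁻¹' {c})) (fun _ => by positivity) id _
      fun φ => ?_
    have := integral_le_Phi_rpow (μ := μ) hσ f φ
    rwa [integral_comp_simpleFunc f (fun x => ‖φ.1 x‖ * ‖x‖ ^ (1 / (1 - σ) - 1))
      (by simp)] at this
  calc (∫ ω, ‖u (f ω)‖ ^ (1 / (1 - σ)) ∂μ) ^ (1 / (1 / (1 - σ)))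
      ≤ (D * Phi 𝕜 (1 / (1 - σ)) σ μ f ^ (1 / (1 - σ))) ^ (1 / (1 / (1 - σ))) := by
        refine Real.rpow_le_rpow (integral_nonneg fun ω => by positivity) key (by positivity)
    _ = _ := by
        rw [Real.mul_rpow hD (by positivity), ← Real.rpow_mul hΦ, one_div_one_div,
          one_div_mul_cancel h1.ne', Real.rpow_one]

/-- The target is a normed space, so the triangle inequality carries the bound by `Phi` to its
convexification. -/
theorem DominatedWith.norm_simpleComp_le [IsFiniteMeasure μ] (hσ₀ : 0 ≤ σ) (hσ : σ < 1)
    {u : X →L[𝕜] Y} {D : ℝ} (hD : 0 ≤ D) (hu : DominatedWith (1 / (1 - σ)) D u)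
    (f : SimpleSpace 𝕜 (1 / (1 - σ)) σ μ X) :
    ‖simpleComp (μ := μ) (1 / (1 - σ)) σ u f‖ ≤ (D ^ (1 - σ) + 1) * ‖f‖ := by
  have h1 : 0 < 1 - σ := by linarith
  have : Fact (1 ≤ ENNReal.ofReal (1 / (1 - σ))) := ⟨by
    rw [ENNReal.one_le_ofReal, le_div_iff₀ h1]; linarith⟩
  have hK : 0 < D ^ (1 - σ) + 1 := by positivity
  rw [← div_le_iff₀' hK]
  refine le_convPhi _ _ _ _ _ fun l hl => ?_
  rw [div_le_iff₀' hK]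
  subst hl
  induction l with
  | nil =>
    have : simpleComp (μ := μ) (1 / (1 - σ)) σ u (0 : SimpleSpace 𝕜 (1 / (1 - σ)) σ μ X) = 0 :=
      map_zero _
    simp only [List.sum_nil, List.map_nil, mul_zero]
    exact (congrArg norm this).le.trans norm_zero.le
  | cons f l ih =>
    have h2 : simpleComp (μ := μ) (1 / (1 - σ)) σ u (f :: l).sum =
        simpleComp (1 / (1 - σ)) σ u f + simpleComp (1 / (1 - σ)) σ u l.sum := map_add _ _ _
    rw [h2, List.map_cons, List.sum_cons, mul_add]
    refine (norm_add_le _ _).trans (add_le_add ?_ ih)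
    refine (hu.norm_simpleComp_le_Phi hσ hD f).trans ?_
    have := Phi_nonneg (𝕜 := 𝕜) (1 / (1 - σ)) σ μ f
    gcongr
    linarith

/-- Boundedness on simple functions extends to the completion. What needs proof is that the
extension is `u ∘ f` on an element represented by `f`: the approximants converge in `L^r` to the one
and weakly to the other. -/
theorem DominatedWith.compContinuous [IsFiniteMeasure μ] (hσ₀ : 0 ≤ σ) (hσ : σ < 1)
    {u : X →L[𝕜] Y} {D : ℝ} (hD : 0 ≤ D) (hu : DominatedWith (1 / (1 - σ)) D u) [CompleteSpace Y] :
    CompContinuous (1 / (1 - σ)) σ μ u := by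
  have h1 : 0 < 1 - σ := by linarith
  set r := 1 / (1 - σ) with hr
  have : Fact (1 ≤ ENNReal.ofReal r) := ⟨by
    rw [ENNReal.one_le_ofReal, le_div_iff₀ h1]; linarith⟩
  set S := ((simpleComp (μ := μ) r σ u).mkNormedAddGroupHom _
    (hu.norm_simpleComp_le hσ₀ hσ hD)).extension with hS
  refine ⟨fun ξ => S ξ.1, fun ξ f hf => ?_, fun ξ => ?_⟩
  · obtain ⟨hf, s, hs, hsf⟩ := hf
    set g := S ξ.1 with hg
    have hSs : ∀ n, S ((show SimpleSpace 𝕜 r σ μ X from s n : SimpleSpace 𝕜 r σ μ X) :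
        SimpleCompletion 𝕜 r σ μ X) = simpleComp (μ := μ) r σ u (s n) := fun n =>
      NormedAddGroupHom.extension_coe _ _
    have hlim : Tendsto (fun n => simpleComp (μ := μ) r σ u (s n)) atTop (𝓝 g) := by
      have := (S.continuous.tendsto ξ.1).comp hs
      refine this.congr fun n => hSs n
    rw [Lp.tendsto_Lp_iff_tendsto_eLpNorm'] at hlim
    have hlim' : Tendsto (fun n => eLpNorm (fun ω => u (s n ω) - g ω) (ENNReal.ofReal r) μ) atTop
        (𝓝 0) := by
      refine hlim.congr fun n => eLpNorm_congr_ae ?_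
      filter_upwards [MemLp.coeFn_toLp ((SimpleFunc.map u (s n)).memLp_of_isFiniteMeasure
        (ENNReal.ofReal r) μ)] with ω hω
      exact congrArg (· - g ω) hω
    have hum : AEStronglyMeasurable (fun ω => u (f ω)) μ :=
      u.continuous.comp_aestronglyMeasurable hf.aestronglyMeasurable
    have hgm : AEStronglyMeasurable g μ := Lp.aestronglyMeasurable g
    have hdm : AEStronglyMeasurable (fun ω => g ω - u (f ω)) μ := hgm.sub hum
    obtain ⟨t, ht, htm⟩ := hdm.isSeparable_ae_range
    -- Only scalar convergence to `u ∘ f` is available, so equality is tested on functionals; the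
    -- essentially separable range makes this enough.
    have hz : (fun ω => g ω - u (f ω)) =ᵐ[μ] 0 := by
      refine ae_eq_zero_of_forall_dual_of_isSeparable 𝕜 ht (fun φ => ?_) htm
      obtain ⟨c, hc⟩ := exists_nnreal_eLpNorm_le_pettisNorm (μ := μ) r (φ ∘L u)
      have hle : ∀ n, eLpNorm (fun ω => φ (g ω - u (f ω))) (ENNReal.ofReal r) μ ≤
          ‖φ‖₊ * eLpNorm (fun ω => u (s n ω) - g ω) (ENNReal.ofReal r) μ +
            c * pettisNorm 𝕜 r μ (fun ω => s n ω - f ω) := fun n => by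
        have hm1 : AEStronglyMeasurable (fun ω => u (s n ω) - g ω) μ :=
          ((SimpleFunc.map u (s n)).aestronglyMeasurable).sub hgm
        have hm2 : AEStronglyMeasurable (fun ω => s n ω - f ω) μ :=
          (s n).aestronglyMeasurable.sub hf.aestronglyMeasurable
        have e : (fun ω => φ (g ω - u (f ω))) = (fun ω => (φ ∘L u) (s n ω - f ω)) -
            fun ω => φ (u (s n ω) - g ω) := by
          ext ω; simp
        rw [e, add_comm]
        refine (eLpNorm_sub_le ((φ ∘L u).continuous.comp_aestronglyMeasurable hm2)
          (φ.continuous.comp_aestronglyMeasurable hm1) Fact.out).trans (add_le_add (hc _) ?_)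
        refine eLpNorm_le_nnreal_smul_eLpNorm_of_ae_le_mul
          (Eventually.of_forall fun ω => φ.le_opNNNorm _) _
      have h0 : Tendsto (fun n => ‖φ‖₊ * eLpNorm (fun ω => u (s n ω) - g ω) (ENNReal.ofReal r) μ +
            c * pettisNorm 𝕜 r μ (fun ω => s n ω - f ω)) atTop (𝓝 0) := by
        have := (ENNReal.Tendsto.const_mul hlim' (Or.inr (ENNReal.coe_ne_top (r := ‖φ‖₊)))).add
          (ENNReal.Tendsto.const_mul hsf (Or.inr (ENNReal.coe_ne_top (r := c))))
        simpa using this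
      have h00 := le_antisymm (ge_of_tendsto' h0 hle) zero_le
      rwa [eLpNorm_eq_zero_iff (φ.continuous.comp_aestronglyMeasurable hdm)
        (zero_lt_one.trans_le Fact.out).ne'] at h00
    filter_upwards [hz] with ω hω
    exact sub_eq_zero.1 hω
  · have h2 : Tendsto (fun η : PettisSpace 𝕜 r σ μ X => S η.1) (𝓝 ξ) (𝓝 (S ξ.1)) :=
      (S.continuous.comp continuous_subtype_val).tendsto ξ
    exact tendsto_iff_norm_sub_tendsto_zero.1 h2

/-! ### Domination from continuity, over a non-atomic measure. -/

theorem NonAtomic.exists_pairwise_disjoint (hμ : NonAtomic μ) (n : ℕ) :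
    ∀ A, MeasurableSet A → 0 < μ A → ∃ B : Fin n → Set Ω, (∀ i, MeasurableSet (B i)) ∧
      (∀ i, 0 < μ (B i)) ∧ (∀ i, B i ⊆ A) ∧ Pairwise (Function.onFun Disjoint B) := by
  induction n with
  | zero => exact fun A _ _ => ⟨fun _ => ∅, fun i => i.elim0, fun i => i.elim0, fun i => i.elim0,
      fun i => i.elim0⟩
  | succ n ih =>
    intro A hA hA0
    obtain ⟨C, hC, hCA, hC0, hlt⟩ := hμ A hA hA0
    have hd : 0 < μ (A \ C) := by
      by_contra h
      have h0 : μ (A \ C) = 0 := le_antisymm (not_lt.1 h) zero_le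
      have := measure_le_inter_add_sdiff μ A C
      rw [h0, add_zero, Set.inter_eq_self_of_subset_right hCA] at this
      exact absurd hlt (not_lt.2 this)
    obtain ⟨B, hB, hB0, hBs, hBd⟩ := ih (A \ C) (hA.diff hC) hd
    refine ⟨Fin.cons C B, ?_, ?_, ?_, ?_⟩
    · exact Fin.cases (by simpa) (by simpa)
    · exact Fin.cases (by simpa) (by simpa)
    · exact Fin.cases (by simpa) fun i => by simpa using (hBs i).trans Set.sdiff_subset
    · have h0 : ∀ j, Disjoint C (B j) := fun j => (Set.disjoint_sdiff_right.mono_right (hBs j))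
      intro i j hij
      induction i using Fin.cases with
      | zero =>
        induction j using Fin.cases with
        | zero => exact absurd rfl hij
        | succ j => exact h0 j
      | succ i =>
        induction j using Fin.cases with
        | zero => exact (h0 i).symm
        | succ j => exact hBd fun h => hij (congrArg Fin.succ h)

/-- The simple function with value `x i` on `B i`, for disjoint sets `B i`. -/
def disjointSimple {n : ℕ} (B : Fin n → Set Ω) (x : Fin n → X) : SimpleFunc Ω X :=
  ∑ i, (SimpleFunc.const Ω (x i)).restrict (B i)

theorem simpleFunc_sum_apply {ι : Type*} (s : Finset ι) (f : ι → SimpleFunc Ω X) (ω : Ω) :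
    (∑ i ∈ s, f i) ω = ∑ i ∈ s, f i ω := by
  classical
  induction s using Finset.induction_on with
  | empty => simp
  | insert i s hi ih => rw [Finset.sum_insert hi, Finset.sum_insert hi, SimpleFunc.add_apply, ih]

theorem integral_comp_disjointSimple [IsFiniteMeasure μ] {n : ℕ} {B : Fin n → Set Ω}
    (hB : ∀ i, MeasurableSet (B i)) (hd : Pairwise (Function.onFun Disjoint B)) (x : Fin n → X)
    (g : X → ℝ) (hg : g 0 = 0) :
    ∫ ω, g (disjointSimple B x ω) ∂μ = ∑ i, μ.real (B i) * g (x i) := by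
  have hval : ∀ ω, disjointSimple B x ω = ∑ i, (B i).indicator (fun _ => x i) ω := fun ω => by
    rw [disjointSimple, simpleFunc_sum_apply]
    refine Finset.sum_congr rfl fun i _ => ?_
    rw [SimpleFunc.restrict_apply _ (hB i)]
    rfl
  have hpt : ∀ ω, g (disjointSimple B x ω) = ∑ i, (B i).indicator (fun _ => g (x i)) ω := by
    intro ω
    rw [hval]
    by_cases h : ∃ i, ω ∈ B i
    · obtain ⟨i, hi⟩ := h
      have hj : ∀ j, j ≠ i → ω ∉ B j := fun j hj hωj =>
        Set.disjoint_left.1 (hd hj) hωj hi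
      rw [Finset.sum_eq_single i (fun j _ h => Set.indicator_of_notMem (hj j h) _) (by simp),
        Finset.sum_eq_single i (fun j _ h => Set.indicator_of_notMem (hj j h) _) (by simp),
        Set.indicator_of_mem hi, Set.indicator_of_mem hi]
    · push Not at h
      rw [Finset.sum_eq_zero fun j _ => Set.indicator_of_notMem (h j) _,
        Finset.sum_eq_zero fun j _ => Set.indicator_of_notMem (h j) _, hg]
  simp_rw [hpt]
  rw [integral_finsetSum _ fun i _ => (integrable_const (g (x i))).indicator (hB i)]
  refine Finset.sum_congr rfl fun i _ => ?_
  rw [integral_indicator_const _ (hB i), smul_eq_mul]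

/-- A finite family, suitably scaled, becomes a step function on disjoint sets; its `Phi` is the
weak side of domination and its image's norm is the strong side. -/
theorem exists_dominatedWith_of_compContinuous [IsFiniteMeasure μ] (hμ : NonAtomic μ)
    (hμ0 : μ ≠ 0) (hσ₀ : 0 ≤ σ) (hσ : σ < 1) {u : X →L[𝕜] Y}
    (hu : CompContinuous (1 / (1 - σ)) σ μ u) :
    ∃ D, 0 ≤ D ∧ DominatedWith (1 / (1 - σ)) D u := by
  have h1 : 0 < 1 - σ := by linarith
  set r := 1 / (1 - σ) with hr
  have hr0 : 0 < r := by positivity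
  have : Fact (1 ≤ ENNReal.ofReal r) := ⟨by
    rw [ENNReal.one_le_ofReal, le_div_iff₀ h1]; linarith⟩
  obtain ⟨T, hT, hc⟩ := hu
  set ι : SimpleFunc Ω X → PettisSpace 𝕜 r σ μ X := fun f =>
    ⟨((show SimpleSpace 𝕜 r σ μ X from f : SimpleSpace 𝕜 r σ μ X) :
      SimpleCompletion 𝕜 r σ μ X), f, represents_coe r σ f⟩ with hι
  have hTι : ∀ f : SimpleFunc Ω X, T (ι f) = simpleComp (μ := μ) r σ u f := fun f => by
    apply Lp.ext
    exact (hT (ι f) f (represents_coe r σ f)).trans (MemLp.coeFn_toLp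
      ((SimpleFunc.map u f).memLp_of_isFiniteMeasure (ENNReal.ofReal r) μ)).symm
  have hT0 : T (ι 0) = 0 := (hTι 0).trans (map_zero (simpleComp (μ := μ) r σ u))
  -- Continuity at `0` suffices; homogeneity of the test functions replaces linearity of `T`.
  obtain ⟨δ, hδ, hδT⟩ := Metric.tendsto_nhds_nhds.1 (hc (ι 0)) 1 one_pos
  have hsmall : ∀ f : SimpleFunc Ω X, Phi 𝕜 r σ μ f < δ → ∫ ω, ‖u (f ω)‖ ^ r ∂μ ≤ 1 := by
    intro f hf
    have hd : dist (ι f) (ι 0) < δ := by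
      have e : dist (ι f) (ι 0) = dist (show SimpleSpace 𝕜 r σ μ X from f) 0 :=
        UniformSpace.Completion.dist_eq _ _
      rw [e, dist_zero_right]
      refine lt_of_le_of_lt ?_ hf
      have := convPhi_le (𝕜 := 𝕜) r σ μ [f]
      simp only [List.sum_cons, List.sum_nil, add_zero, List.map_cons, List.map_nil] at this
      exact this
    have h2 := hδT hd
    rw [hT0, sub_zero, hTι, Real.dist_eq, sub_zero, abs_of_nonneg (norm_nonneg _)] at h2
    have h3 : (∫ ω, ‖u (f ω)‖ ^ r ∂μ) ^ (1 / r) < 1 := by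
      exact (norm_toLp_simpleFunc hr0 (SimpleFunc.map u f)).symm.trans_lt h2
    by_contra hcon
    exact absurd h3 (not_lt.2 (Real.one_le_rpow (not_le.1 hcon).le (by positivity)))
  have hpos : 0 < (δ / 2) ^ r := by positivity
  have main : ∀ (n : ℕ) (x : Fin n → X) (B : ℝ), 0 < B →
      (∀ φ : DualBall 𝕜 X, ∑ i, ‖φ.1 (x i)‖ * ‖x i‖ ^ (r - 1) ≤ B) →
        ∑ i, ‖u (x i)‖ ^ r ≤ ((δ / 2) ^ r)⁻¹ * B := by
    intro n x B hB hx
    obtain ⟨A, hA, hA0, -, hd⟩ := hμ.exists_pairwise_disjoint n Set.univ MeasurableSet.univ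
      (by simpa [pos_iff_ne_zero] using hμ0)
    have hm : ∀ i, 0 < μ.real (A i) := fun i =>
      ENNReal.toReal_pos (hA0 i).ne' (measure_ne_top _ _)
    -- The factor `1 / μ(A i)` cancels the measure of the set, and `τ` scales the step function so
    -- that its `Phi` is at most `δ / 2`.
    set τ := (δ / 2) ^ r / B with hτ
    have hτ0 : 0 < τ := by positivity
    have hw : ∀ i, 0 ≤ τ / μ.real (A i) := fun i => by have := hm i; positivity
    set f := disjointSimple A fun i => (((τ / μ.real (A i)) ^ (1 / r) : ℝ) : 𝕜) • x i with hf
    have hΦ : Phi 𝕜 r σ μ f ≤ δ / 2 := by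
      rw [hr, Phi_eq hσ, ← hr]
      refine ciSup_le fun φ => ?_
      rw [hf, integral_comp_disjointSimple hA hd _ (fun x => ‖φ.1 x‖ * ‖x‖ ^ (r - 1)) (by simp)]
      simp_rw [norm_mul_norm_smul hr0.ne' (hw _)]
      have : ∑ i, μ.real (A i) * (τ / μ.real (A i) * (‖φ.1 (x i)‖ * ‖x i‖ ^ (r - 1))) =
          τ * ∑ i, ‖φ.1 (x i)‖ * ‖x i‖ ^ (r - 1) := by
        rw [Finset.mul_sum]
        refine Finset.sum_congr rfl fun i _ => ?_
        have := (hm i).ne'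
        field_simp
      rw [this]
      calc _ ≤ ((δ / 2) ^ r) ^ (1 - σ) := by
            gcongr
            calc _ ≤ τ * B := by gcongr; exact hx φ
              _ = _ := by rw [hτ]; field_simp
        _ = δ / 2 := by
            rw [← Real.rpow_mul (by positivity), hr, one_div_mul_cancel h1.ne', Real.rpow_one]
    have h2 := hsmall f (by linarith)
    rw [hf, integral_comp_disjointSimple hA hd _ (fun x => ‖u x‖ ^ r)
      (by simp [Real.zero_rpow hr0.ne'])] at h2
    simp_rw [map_smul, norm_ofReal_smul_rpow hr0.ne' (hw _)] at h2
    have : ∑ i, μ.real (A i) * (τ / μ.real (A i) * ‖u (x i)‖ ^ r) = τ * ∑ i, ‖u (x i)‖ ^ r := by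
      rw [Finset.mul_sum]
      refine Finset.sum_congr rfl fun i _ => ?_
      have := (hm i).ne'
      field_simp
    rw [this, hτ] at h2
    rw [inv_mul_eq_div, le_div_iff₀ hpos, mul_comm]
    rw [div_mul_eq_mul_div, div_le_one hB] at h2
    exact h2
  refine ⟨((δ / 2) ^ r)⁻¹, by positivity, fun n x B hB => ?_⟩
  have hB0 : 0 ≤ B := (Finset.sum_nonneg fun i _ => by positivity).trans (hB ⟨0, by simp⟩)
  refine le_of_forall_pos_le_add fun ε hε => ?_
  have := main n x (B + (δ / 2) ^ r * ε) (by positivity) fun φ => (hB φ).trans (by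
    have := mul_pos hpos hε
    linarith)
  refine this.trans (le_of_eq ?_)
  field_simp

end Composition

end AbsContOp

namespace AbsContOp

/-! ### Domination for `(r,1)`-summing operators on `C(K)`. -/

section ContinuousFunctions

variable {𝕜 : Type*} [RCLike 𝕜] {K : Type*} [TopologicalSpace K]

variable (𝕜) in
/-- A real continuous function, viewed as a function with values in `𝕜`. -/
def ofRealC (c : C(K, ℝ)) : C(K, 𝕜) := ⟨fun t => (c t : 𝕜), by fun_prop⟩

@[simp]
theorem ofRealC_apply (c : C(K, ℝ)) (t : K) : ofRealC 𝕜 c t = (c t : 𝕜) := rfl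

theorem ofRealC_smul (a : ℝ) (c : C(K, ℝ)) : ofRealC 𝕜 (a • c) = (a : 𝕜) • ofRealC 𝕜 c := by
  ext t; simp

variable [CompactSpace K] {Y : Type*} [NormedAddCommGroup Y] [NormedSpace 𝕜 Y]

/-- Unimodular scalars `c i` turn the sum into `φ (∑ c i • x i)`, and the sup norm of that
combination is at most `B`. -/
theorem sum_norm_dual_le_of_pointwise {n : ℕ} (x : Fin n → C(K, 𝕜)) {B : ℝ} (hB : 0 ≤ B)
    (hx : ∀ t, ∑ i, ‖x i t‖ ≤ B) (φ : DualBall 𝕜 C(K, 𝕜)) : ∑ i, ‖φ.1 (x i)‖ ≤ B := by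
  have hz : ∀ i, ∃ c : 𝕜, ‖c‖ = 1 ∧ c * φ.1 (x i) = ‖φ.1 (x i)‖ := fun i => by
    obtain ⟨c, hc, h⟩ := RCLike.exists_norm_eq_mul_self (φ.1 (x i))
    exact ⟨c, hc, h.symm⟩
  choose c hc hcφ using hz
  have h1 : φ.1 (∑ i, c i • x i) = ((∑ i, ‖φ.1 (x i)‖ : ℝ) : 𝕜) := by
    simp [map_sum, hcφ]
  have h2 : ‖∑ i, c i • x i‖ ≤ B := by
    refine (ContinuousMap.norm_le _ hB).2 fun t => ?_
    rw [ContinuousMap.sum_apply]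
    refine (norm_sum_le _ _).trans (le_trans (le_of_eq ?_) (hx t))
    simp [hc]
  have h3 := norm_apply_le_of_dualBall φ (∑ i, c i • x i)
  rw [h1, RCLike.norm_ofReal, abs_of_nonneg (by positivity)] at h3
  exact h3.trans h2

theorem summing_one_pointwise {r : ℝ} (hr : 1 ≤ r) {u : C(K, 𝕜) →L[𝕜] Y}
    (hu : u ∈ summing 𝕜 C(K, 𝕜) Y r 1) : ∃ C : ℝ, ∀ (n : ℕ) (x : Fin n → C(K, 𝕜)),
      (∀ t, ∑ i, ‖x i t‖ ≤ 1) → ∑ i, ‖u (x i)‖ ^ r ≤ C := by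
  obtain ⟨C, hC, h⟩ := hu
  have hr0 : 0 < r := by linarith
  refine ⟨C ^ r, fun n x hx => ?_⟩
  have h1 : (∑ i, ‖u (x i)‖ ^ r) ^ (1 / r) ≤ C := by
    refine (h n x).trans ?_
    conv_rhs => rw [← mul_one C]
    gcongr
    refine ciSup_le fun φ => ?_
    simpa using sum_norm_dual_le_of_pointwise x zero_le_one hx φ
  have h2 := Real.rpow_le_rpow (by positivity) h1 hr0.le
  rwa [← Real.rpow_mul (by positivity), one_div_mul_cancel hr0.ne', Real.rpow_one] at h2

/-- Pisier's domination theorem, up to an error `ε`: on `[0, 1]`-valued functions, the norm of `u`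
is controlled by a functional of norm at most `S`. -/
theorem exists_functional_of_pointwise {r : ℝ} (hr : 1 ≤ r) {u : C(K, 𝕜) →L[𝕜] Y} {C : ℝ}
    (hC : ∀ (n : ℕ) (x : Fin n → C(K, 𝕜)), (∀ t, ∑ i, ‖x i t‖ ≤ 1) → ∑ i, ‖u (x i)‖ ^ r ≤ C) :
    ∃ S : ℝ, 0 ≤ S ∧ ∀ ε : ℝ, 0 < ε → ∃ Ψ : C(K, ℝ) →ₗ[ℝ] ℝ, (∀ c, Ψ c ≤ S * ‖c‖) ∧
      ∀ c : C(K, ℝ), (∀ t, 0 ≤ c t) → (∀ t, c t ≤ 1) → ‖u (ofRealC 𝕜 c)‖ ^ r ≤ ε + r * Ψ c := by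
  have hr0 : 0 < r := by linarith
  set V : Set ℝ := {s | ∃ (n : ℕ) (x : Fin n → C(K, 𝕜)), (∀ t, ∑ i, ‖x i t‖ ≤ 1) ∧
    s = ∑ i, ‖u (x i)‖ ^ r} with hV
  have hVb : BddAbove V := ⟨C, by rintro _ ⟨n, x, hx, rfl⟩; exact hC n x hx⟩
  have hV0 : (0 : ℝ) ∈ V := ⟨0, fun i => i.elim0, by simp, by simp⟩
  set S := sSup V with hS
  have hle : ∀ (n : ℕ) (x : Fin n → C(K, 𝕜)), (∀ t, ∑ i, ‖x i t‖ ≤ 1) →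
    ∑ i, ‖u (x i)‖ ^ r ≤ S := fun n x hx => le_csSup hVb ⟨n, x, hx, rfl⟩
  have hS0 : 0 ≤ S := le_csSup hVb hV0
  refine ⟨S, hS0, fun ε hε => ?_⟩
  -- A family extremal up to `ε`: perturbing it within the admissible class gains at most `ε`.
  obtain ⟨_, ⟨n, x, hx, rfl⟩, hxS⟩ := exists_lt_of_lt_csSup ⟨0, hV0⟩ (sub_lt_self S hε)
  choose g hg hgx using fun k => exists_dual_vector'' 𝕜 (u (x k))
  set b : Fin n → ℝ := fun k => ‖u (x k)‖ with hb
  have hb0 : ∀ k, 0 ≤ b k := fun k => norm_nonneg _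
  -- `r * Ψ c` is the first-order loss in `∑ ‖u (x k)‖ ^ r` when each `x k` is replaced by `(1 - c)
  -- x k`, computed with norming functionals `g k`.
  let Ψ : C(K, ℝ) →ₗ[ℝ] ℝ :=
    { toFun := fun c => ∑ k, b k ^ (r - 1) * RCLike.re (g k (u (ofRealC 𝕜 c * x k)))
      map_add' := fun c d => by
        rw [← Finset.sum_add_distrib]
        refine Finset.sum_congr rfl fun k _ => ?_
        have : ofRealC 𝕜 (c + d) * x k = ofRealC 𝕜 c * x k + ofRealC 𝕜 d * x k := by
          ext t; simp [add_mul]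
        rw [this, map_add, map_add, map_add, mul_add]
      map_smul' := fun a c => by
        rw [RingHom.id_apply, smul_eq_mul, Finset.mul_sum]
        refine Finset.sum_congr rfl fun k _ => ?_
        rw [ofRealC_smul, smul_mul_assoc, map_smul, map_smul, smul_eq_mul, RCLike.re_ofReal_mul]
        ring }
  have hΨ : ∀ c, Ψ c = ∑ k, b k ^ (r - 1) * RCLike.re (g k (u (ofRealC 𝕜 c * x k))) :=
    fun c => rfl
  have hre : ∀ k (z : Y), RCLike.re (g k z) ≤ ‖z‖ := fun k z =>
    (RCLike.re_le_norm _).trans (((g k).le_of_opNorm_le (hg k) z).trans (one_mul _).le)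
  have hone : ∀ c : C(K, ℝ), ‖c‖ ≤ 1 → Ψ c ≤ S := fun c hc => by
    have h1 : ∑ k, ‖u (ofRealC 𝕜 c * x k)‖ ^ r ≤ S := hle n _ fun t => by
      refine le_trans (Finset.sum_le_sum fun k _ => ?_) (hx t)
      rw [ContinuousMap.mul_apply, norm_mul, ofRealC_apply, RCLike.norm_ofReal]
      exact mul_le_of_le_one_left (norm_nonneg _) ((c.norm_coe_le_norm t).trans hc)
    have h2 : r * Ψ c ≤ r * S := by
      calc r * Ψ c ≤ ∑ k, r * (b k ^ (r - 1) * ‖u (ofRealC 𝕜 c * x k)‖) := by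
            rw [hΨ, Finset.mul_sum]
            have := hb0
            gcongr
            exact hre _ _
        _ ≤ ∑ k, ((r - 1) * b k ^ r + ‖u (ofRealC 𝕜 c * x k)‖ ^ r) :=
            Finset.sum_le_sum fun k _ => young_tangent hr (hb0 k) (norm_nonneg _)
        _ = (r - 1) * ∑ k, b k ^ r + ∑ k, ‖u (ofRealC 𝕜 c * x k)‖ ^ r := by
            rw [Finset.sum_add_distrib, ← Finset.mul_sum]
        _ ≤ (r - 1) * S + S := by
            have := hle n x hx
            have : 0 ≤ r - 1 := by linarith
            gcongr
        _ = r * S := by ring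
    exact le_of_mul_le_mul_left h2 hr0
  refine ⟨Ψ, fun c => ?_, fun c hc0 hc1 => ?_⟩
  · rcases (norm_nonneg c).eq_or_lt with h | h
    · rw [← h, norm_eq_zero.1 h.symm, map_zero, mul_zero]
    · have := hone (‖c‖⁻¹ • c) (by rw [norm_smul, norm_inv, norm_norm, inv_mul_cancel₀ h.ne'])
      rwa [map_smul, smul_eq_mul, inv_mul_le_iff₀ h, mul_comm] at this
  -- Adjoining `c` to the functions `(1 - c) x k` stays admissible, since pointwise `c + (1 - c) ∑
  -- |x k| ≤ 1`.
  · have h1 : ‖u (ofRealC 𝕜 c)‖ ^ r + ∑ k, ‖u (x k - ofRealC 𝕜 c * x k)‖ ^ r ≤ S := by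
      have := hle (n + 1) (Fin.cons (ofRealC 𝕜 c) fun k => x k - ofRealC 𝕜 c * x k) fun t => by
        rw [Fin.sum_univ_succ]
        simp only [Fin.cons_zero, Fin.cons_succ, ofRealC_apply, ContinuousMap.sub_apply,
          ContinuousMap.mul_apply, RCLike.norm_ofReal, abs_of_nonneg (hc0 t)]
        have : ∀ k, ‖x k t - (c t : 𝕜) * x k t‖ = (1 - c t) * ‖x k t‖ := fun k => by
          rw [← one_sub_mul, norm_mul, ← RCLike.ofReal_one, ← RCLike.ofReal_sub,
            RCLike.norm_ofReal, abs_of_nonneg (by linarith [hc1 t])]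
        simp_rw [this]
        rw [← Finset.mul_sum]
        have h3 : (1 - c t) * ∑ k, ‖x k t‖ ≤ (1 - c t) * 1 :=
          mul_le_mul_of_nonneg_left (hx t) (by linarith [hc1 t])
        linarith
      simpa [Fin.sum_univ_succ] using this
    -- The tangent inequality at `b k` bounds the loss by its linear part; near-extremality then
    -- gives the claim.
    have h2 : ∑ k, (b k ^ r - r * (b k ^ (r - 1) * RCLike.re (g k (u (ofRealC 𝕜 c * x k))))) ≤
        ∑ k, ‖u (x k - ofRealC 𝕜 c * x k)‖ ^ r := by
      refine Finset.sum_le_sum fun k _ => ?_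
      have h3 := young_tangent hr (hb0 k) (norm_nonneg (u (x k - ofRealC 𝕜 c * x k)))
      have h4 := hre k (u (x k - ofRealC 𝕜 c * x k))
      rw [map_sub, map_sub, map_sub, hgx, RCLike.ofReal_re] at h4
      have h5 : r * (b k ^ (r - 1) * (b k - RCLike.re (g k (u (ofRealC 𝕜 c * x k))))) ≤
          r * (b k ^ (r - 1) * ‖u (x k - ofRealC 𝕜 c * x k)‖) := by
        have := hb0 k
        rw [map_sub]
        gcongr
      have h6 := mul_rpow_sub_one hr0.ne' (hb0 k)
      have h7 : r * (b k ^ (r - 1) * (b k - RCLike.re (g k (u (ofRealC 𝕜 c * x k))))) =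
          r * b k ^ r - r * (b k ^ (r - 1) * RCLike.re (g k (u (ofRealC 𝕜 c * x k)))) := by
        rw [← h6]; ring
      linarith
    rw [Finset.sum_sub_distrib, ← Finset.mul_sum, ← hΨ] at h2
    linarith

/-- Normalise each `c i` by `m i`, apply the functional bound, and sum by linearity of `Ψ`; the norm
bound is then used once, on `∑ m i ^ (r - 1) • c i`. The total error is `ε ∑ m i ^ r`, which is
arbitrarily small. -/
theorem sum_rpow_le_of_nonneg {r : ℝ} (hr : 1 ≤ r) {u : C(K, 𝕜) →L[𝕜] Y} {S : ℝ}
    (hS : ∀ ε : ℝ, 0 < ε → ∃ Ψ : C(K, ℝ) →ₗ[ℝ] ℝ, (∀ c, Ψ c ≤ S * ‖c‖) ∧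
      ∀ c : C(K, ℝ), (∀ t, 0 ≤ c t) → (∀ t, c t ≤ 1) → ‖u (ofRealC 𝕜 c)‖ ^ r ≤ ε + r * Ψ c)
    (hS0 : 0 ≤ S) {n : ℕ} (c : Fin n → C(K, ℝ)) (m : Fin n → ℝ) (hm : ∀ i, 0 ≤ m i)
    (hc0 : ∀ i t, 0 ≤ c i t) (hcm : ∀ i t, c i t ≤ m i) {B : ℝ} (hB0 : 0 ≤ B)
    (hB : ∀ t, ∑ i, m i ^ (r - 1) * c i t ≤ B) :
    ∑ i, ‖u (ofRealC 𝕜 (c i))‖ ^ r ≤ r * S * B := by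
  have hr0 : 0 < r := by linarith
  have key : ∀ ε : ℝ, 0 < ε → ∑ i, ‖u (ofRealC 𝕜 (c i))‖ ^ r ≤ r * S * B + ε * ∑ i, m i ^ r := by
    intro ε hε
    obtain ⟨Ψ, hΨ, h⟩ := hS ε hε
    have h1 : ∀ i, ‖u (ofRealC 𝕜 (c i))‖ ^ r ≤ ε * m i ^ r + r * Ψ (m i ^ (r - 1) • c i) := by
      intro i
      rcases (hm i).eq_or_lt with h0 | h0
      · have : c i = 0 := by
          ext t; exact le_antisymm ((hcm i t).trans h0.ge) (hc0 i t)
        have h2 : ofRealC 𝕜 (0 : C(K, ℝ)) = 0 := by ext t; simp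
        rw [this, h2, map_zero, norm_zero, Real.zero_rpow hr0.ne', smul_zero, map_zero, mul_zero,
          add_zero]
        have := hm i
        positivity
      · have h2 := h ((m i)⁻¹ • c i) (fun t => mul_nonneg (inv_nonneg.2 (hm i)) (hc0 i t))
          (fun t => by
            change (m i)⁻¹ * c i t ≤ 1
            rw [inv_mul_le_iff₀ h0, mul_one]; exact hcm i t)
        rw [ofRealC_smul, map_smul, norm_smul, RCLike.norm_ofReal, abs_of_pos (inv_pos.2 h0),
          Real.mul_rpow (inv_nonneg.2 (hm i)) (norm_nonneg _), Real.inv_rpow (hm i),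
          inv_mul_le_iff₀ (by positivity), map_smul, smul_eq_mul] at h2
        refine h2.trans (le_of_eq ?_)
        rw [map_smul, smul_eq_mul, ← mul_rpow_sub_one hr0.ne' (hm i)]
        field_simp
    have h2 : ‖∑ i, m i ^ (r - 1) • c i‖ ≤ B := by
      refine (ContinuousMap.norm_le _ hB0).2 fun t => ?_
      rw [ContinuousMap.sum_apply, Real.norm_of_nonneg]
      · exact hB t
      · exact Finset.sum_nonneg fun i _ => mul_nonneg (Real.rpow_nonneg (hm i) _) (hc0 i t)
    calc ∑ i, ‖u (ofRealC 𝕜 (c i))‖ ^ r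
        ≤ ∑ i, (ε * m i ^ r + r * Ψ (m i ^ (r - 1) • c i)) := Finset.sum_le_sum fun i _ => h1 i
      _ = ε * ∑ i, m i ^ r + r * Ψ (∑ i, m i ^ (r - 1) • c i) := by
          rw [Finset.sum_add_distrib, ← Finset.mul_sum, ← Finset.mul_sum, map_sum]
      _ ≤ ε * ∑ i, m i ^ r + r * (S * B) := by
          gcongr
          exact (hΨ _).trans (by gcongr)
      _ = _ := by ring
  have hM : 0 ≤ ∑ i, m i ^ r := Finset.sum_nonneg fun i _ => Real.rpow_nonneg (hm i) _
  refine le_of_forall_pos_le_add fun ε hε => (key (ε / (∑ i, m i ^ r + 1)) (by positivity)).trans ?_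
  gcongr
  rw [div_mul_eq_mul_div, div_le_iff₀ (by positivity)]
  gcongr
  linarith

/-- Point evaluations make the weak bound pointwise. Each `x i` splits into positive and negative
parts of its real and imaginary parts, all dominated by `‖x i t‖`; the four pieces account for the
factor `4 ^ (r - 1) * 4`. -/
theorem exists_dominatedWith_of_mem_summing_one {r : ℝ} (hr : 1 ≤ r) {u : C(K, 𝕜) →L[𝕜] Y}
    (hu : u ∈ summing 𝕜 C(K, 𝕜) Y r 1) : ∃ D, 0 ≤ D ∧ DominatedWith r D u := by
  have hr0 : 0 < r := by linarith
  obtain ⟨C, hC⟩ := summing_one_pointwise hr hu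
  obtain ⟨S, hS0, hS⟩ := exists_functional_of_pointwise hr hC
  refine ⟨4 ^ (r - 1) * (4 * (r * S)), by positivity, fun n x B hB => ?_⟩
  have hB0 : 0 ≤ B := (Finset.sum_nonneg fun i _ => by positivity).trans (hB ⟨0, by simp⟩)
  have hBt : ∀ t, ∑ i, ‖x i‖ ^ (r - 1) * ‖x i t‖ ≤ B := fun t => by
    have hφ : ‖(ContinuousMap.evalCLM 𝕜 t : C(K, 𝕜) →L[𝕜] 𝕜)‖ ≤ 1 :=
      ContinuousLinearMap.opNorm_le_bound _ zero_le_one fun f => by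
        rw [one_mul]; exact f.norm_coe_le_norm t
    refine le_trans (le_of_eq (Finset.sum_congr rfl fun i _ => mul_comm _ _)) (hB ⟨_, hφ⟩)
  let R : Fin n → C(K, ℝ) := fun i => ⟨fun t => RCLike.re (x i t), by fun_prop⟩
  let J : Fin n → C(K, ℝ) := fun i => ⟨fun t => RCLike.im (x i t), by fun_prop⟩
  let c : Fin 4 → Fin n → C(K, ℝ) := ![fun i => R i ⊔ 0, fun i => (-R i) ⊔ 0, fun i => J i ⊔ 0,
    fun i => (-J i) ⊔ 0]
  have hc0 : ∀ j i t, 0 ≤ c j i t := by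
    intro j i t
    fin_cases j <;> exact le_max_right _ _
  have hcx : ∀ j i t, c j i t ≤ ‖x i t‖ := by
    intro j i t
    have h1 := abs_le.1 (RCLike.abs_re_le_norm (x i t))
    have h2 := abs_le.1 (RCLike.abs_im_le_norm (x i t))
    fin_cases j <;> refine max_le ?_ (norm_nonneg _)
    exacts [h1.2, neg_le.1 h1.1, h2.2, neg_le.1 h2.1]
  have hsum : ∀ j, ∑ i, ‖u (ofRealC 𝕜 (c j i))‖ ^ r ≤ r * S * B := fun j =>
    sum_rpow_le_of_nonneg hr hS hS0 (c j) (fun i => ‖x i‖) (fun i => norm_nonneg _) (hc0 j)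
      (fun i t => (hcx j i t).trans ((x i).norm_coe_le_norm t)) hB0 fun t =>
      (Finset.sum_le_sum fun i _ => mul_le_mul_of_nonneg_left (hcx j i t) (by positivity)).trans
        (hBt t)
  have hdec : ∀ i, x i = (ofRealC 𝕜 (c 0 i) - ofRealC 𝕜 (c 1 i)) +
      (RCLike.I : 𝕜) • (ofRealC 𝕜 (c 2 i) - ofRealC 𝕜 (c 3 i)) := by
    intro i
    ext t
    have hmax : ∀ a : ℝ, max a 0 - max (-a) 0 = a := fun a => by
      rcases le_total 0 a with h | h
      · rw [max_eq_left h, max_eq_right (by linarith), sub_zero]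
      · rw [max_eq_right h, max_eq_left (by linarith)]; ring
    have e1 : c 0 i t - c 1 i t = RCLike.re (x i t) := hmax _
    have e2 : c 2 i t - c 3 i t = RCLike.im (x i t) := hmax _
    simp only [ContinuousMap.add_apply, ContinuousMap.sub_apply, ContinuousMap.smul_apply,
      ofRealC_apply, smul_eq_mul]
    rw [← RCLike.ofReal_sub, ← RCLike.ofReal_sub, e1, e2, mul_comm]
    exact (RCLike.re_add_im (x i t)).symm
  have hpt : ∀ i, ‖u (x i)‖ ^ r ≤ 4 ^ (r - 1) * ∑ j, ‖u (ofRealC 𝕜 (c j i))‖ ^ r := by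
    intro i
    have h1 : ‖u (x i)‖ ≤ ∑ j, |‖u (ofRealC 𝕜 (c j i))‖| := by
      simp only [abs_norm, Fin.sum_univ_four]
      conv_lhs => rw [hdec i, map_add, map_smul, map_sub, map_sub]
      have h2 := norm_sub_le (u (ofRealC 𝕜 (c 0 i))) (u (ofRealC 𝕜 (c 1 i)))
      have h3 := norm_sub_le (u (ofRealC 𝕜 (c 2 i))) (u (ofRealC 𝕜 (c 3 i)))
      refine (norm_add_le _ _).trans ?_
      rw [norm_smul]
      have h4 : ‖(RCLike.I : 𝕜)‖ ≤ 1 := by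
        rw [RCLike.norm_I]; split_ifs <;> norm_num
      have := mul_le_of_le_one_left (norm_nonneg (u (ofRealC 𝕜 (c 2 i)) - u (ofRealC 𝕜 (c 3 i)))) h4
      linarith
    refine (Real.rpow_le_rpow (norm_nonneg _) h1 hr0.le).trans ?_
    have := Real.rpow_sum_le_const_mul_sum_rpow Finset.univ
      (fun j => ‖u (ofRealC 𝕜 (c j i))‖) hr
    simpa using this
  calc ∑ i, ‖u (x i)‖ ^ r ≤ ∑ i, 4 ^ (r - 1) * ∑ j, ‖u (ofRealC 𝕜 (c j i))‖ ^ r :=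
        Finset.sum_le_sum fun i _ => hpt i
    _ = 4 ^ (r - 1) * ∑ j, ∑ i, ‖u (ofRealC 𝕜 (c j i))‖ ^ r := by
        rw [← Finset.mul_sum, Finset.sum_comm]
    _ ≤ 4 ^ (r - 1) * ∑ _j : Fin 4, r * S * B := by
        gcongr with j
        exact hsum j
    _ = _ := by simp; ring

end ContinuousFunctions

end AbsContOp

namespace AbsContOp

/-! ### The little Grothendieck theorem on finite `ℓ^∞`. -/

section LittleGrothendieck

variable {𝕜 : Type*} [RCLike 𝕜]
variable {H : Type*} [NormedAddCommGroup H] [InnerProductSpace 𝕜 H]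

/-- The sum `∑ i, ± y i` for a choice `ε` of signs. -/
def signSum {E : Type*} [AddCommGroup E] {n : ℕ} (ε : Fin n → Bool) (y : Fin n → E) : E :=
  ∑ i, if ε i then y i else -y i

theorem sum_signSum_succ {E : Type*} [AddCommGroup E] {n : ℕ} (y : Fin (n + 1) → E) (F : E → ℝ) :
    ∑ ε, F (signSum ε y) =
      ∑ ε, (F (signSum ε (Fin.tail y) + y 0) + F (signSum ε (Fin.tail y) - y 0)) := by
  rw [← (Fin.consEquiv fun _ => Bool).sum_comp, Fintype.sum_prod_type, Fintype.sum_bool,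
    ← Finset.sum_add_distrib]
  refine Finset.sum_congr rfl fun ε _ => ?_
  congr 2 <;> simp [signSum, Fin.sum_univ_succ, Fin.consEquiv, Fin.tail, add_comm,
    sub_eq_add_neg]

theorem sum_norm_signSum_sq (𝕜 : Type*) [RCLike 𝕜] {H : Type*} [NormedAddCommGroup H]
    [InnerProductSpace 𝕜 H] {n : ℕ} (y : Fin n → H) :
    ∑ ε, ‖signSum ε y‖ ^ 2 = 2 ^ n * ∑ i, ‖y i‖ ^ 2 := by
  induction n with
  | zero => simp [signSum]
  | succ n ih =>
    rw [sum_signSum_succ y fun z => ‖z‖ ^ 2]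
    have h : ∀ ε, ‖signSum ε (Fin.tail y) + y 0‖ ^ 2 + ‖signSum ε (Fin.tail y) - y 0‖ ^ 2 =
        2 * ‖signSum ε (Fin.tail y)‖ ^ 2 + 2 * ‖y 0‖ ^ 2 := fun ε => by
      have := parallelogram_law_with_norm 𝕜 (signSum ε (Fin.tail y)) (y 0)
      linarith
    simp_rw [h]
    rw [Finset.sum_add_distrib, ← Finset.mul_sum, ih, Fin.sum_univ_succ]
    simp [Fin.tail]
    ring

/-- Khintchine's inequality for exponent `4`, by induction: averaging over one sign cancels the odd
powers of the inner product, and Cauchy–Schwarz bounds its square. -/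
theorem sum_norm_signSum_pow_four_le (𝕜 : Type*) [RCLike 𝕜] {H : Type*} [NormedAddCommGroup H]
    [InnerProductSpace 𝕜 H] {n : ℕ} (y : Fin n → H) :
    ∑ ε, ‖signSum ε y‖ ^ 4 ≤ 3 * 2 ^ n * (∑ i, ‖y i‖ ^ 2) ^ 2 := by
  induction n with
  | zero => simp [signSum]
  | succ n ih =>
    rw [sum_signSum_succ y fun z => ‖z‖ ^ 4]
    have h : ∀ ε, ‖signSum ε (Fin.tail y) + y 0‖ ^ 4 + ‖signSum ε (Fin.tail y) - y 0‖ ^ 4 ≤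
        2 * ‖signSum ε (Fin.tail y)‖ ^ 4 + 12 * ‖y 0‖ ^ 2 * ‖signSum ε (Fin.tail y)‖ ^ 2 +
          2 * ‖y 0‖ ^ 4 := fun ε => by
      set S := signSum ε (Fin.tail y)
      have h1 := norm_add_sq (𝕜 := 𝕜) S (y 0)
      have h2 := norm_sub_sq (𝕜 := 𝕜) S (y 0)
      have h3 : RCLike.re (inner 𝕜 S (y 0)) ^ 2 ≤ ‖S‖ ^ 2 * ‖y 0‖ ^ 2 := by
        rw [← mul_pow, ← sq_abs]
        exact pow_le_pow_left₀ (abs_nonneg _)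
          ((RCLike.abs_re_le_norm _).trans (norm_inner_le_norm _ _)) 2
      calc ‖S + y 0‖ ^ 4 + ‖S - y 0‖ ^ 4 = (‖S + y 0‖ ^ 2) ^ 2 + (‖S - y 0‖ ^ 2) ^ 2 := by ring
        _ = 2 * (‖S‖ ^ 2 + ‖y 0‖ ^ 2) ^ 2 + 8 * RCLike.re (inner 𝕜 S (y 0)) ^ 2 := by
            rw [h1, h2]; ring
        _ ≤ _ := by nlinarith
    refine (Finset.sum_le_sum fun ε _ => h ε).trans ?_
    rw [Finset.sum_add_distrib, Finset.sum_add_distrib, ← Finset.mul_sum, ← Finset.mul_sum,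
      sum_norm_signSum_sq 𝕜, Fin.sum_univ_succ]
    have h0 := ih (Fin.tail y)
    simp only [Finset.sum_const, Finset.card_univ, Fintype.card_pi, Fintype.card_bool,
      Finset.prod_const, Fintype.card_fin, nsmul_eq_mul, Nat.cast_pow, Nat.cast_ofNat]
    change _ ≤ 3 * 2 ^ (n + 1) * (‖y 0‖ ^ 2 + ∑ i, ‖Fin.tail y i‖ ^ 2) ^ 2
    set A := ∑ i, ‖Fin.tail y i‖ ^ 2
    -- The terms in `A ^ 2` and `A * ‖y 0‖ ^ 2` match exactly; this quantity is the slack.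
    have h4 : (0 : ℝ) ≤ 2 ^ n * ‖y 0‖ ^ 4 := by positivity
    rw [pow_succ (2 : ℝ)]
    nlinarith

theorem signSum_apply {ι : Type*} {E : ι → Type*} [∀ i, AddCommGroup (E i)] {n : ℕ}
    (ε : Fin n → Bool) (f : Fin n → ∀ i, E i) (t : ι) :
    signSum ε f t = signSum ε fun i => f i t := by
  rw [signSum, Finset.sum_apply]
  refine Finset.sum_congr rfl fun i _ => ?_
  split_ifs <;> rfl

theorem map_signSum {E F : Type*} [AddCommGroup E] [AddCommGroup F] [Module 𝕜 E] [Module 𝕜 F]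
    (v : E →ₗ[𝕜] F) {n : ℕ} (ε : Fin n → Bool) (f : Fin n → E) :
    v (signSum ε f) = signSum ε fun i => v (f i) := by
  rw [signSum, map_sum]
  refine Finset.sum_congr rfl fun i _ => ?_
  split_ifs <;> simp

/-- The little Grothendieck theorem for `ℓ^∞(ι)`, in homogeneous form. -/
theorem sum_norm_sq_le_of_pointwise_one {ι : Type*} [Fintype ι] (v : (ι → 𝕜) →ₗ[𝕜] H) {c : ℝ}
    (hv : ∀ f, ‖v f‖ ≤ c * ‖f‖) {n : ℕ} (f : Fin n → ι → 𝕜)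
    (hf : ∀ t, ∑ i, ‖f i t‖ ^ 2 ≤ 1) : ∑ i, ‖v (f i)‖ ^ 2 ≤ 48 * c ^ 2 := by
  set V : Set ℝ := {s | ∃ (n : ℕ) (f : Fin n → ι → 𝕜), (∀ t, ∑ i, ‖f i t‖ ^ 2 ≤ 1) ∧
    s = ∑ i, ‖v (f i)‖ ^ 2} with hV
  -- A crude bound depending on the size of `ι`; it is needed only so that `S` is a true supremum
  -- and can be absorbed.
  have hVb : BddAbove V := by
    refine ⟨c ^ 2 * Fintype.card ι, ?_⟩
    rintro _ ⟨n, f, hf, rfl⟩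
    calc ∑ i, ‖v (f i)‖ ^ 2 ≤ ∑ i, c ^ 2 * ∑ t, ‖f i t‖ ^ 2 := by
          refine Finset.sum_le_sum fun i _ => ?_
          have h1 : ‖f i‖ ^ 2 ≤ ∑ t, ‖f i t‖ ^ 2 := by
            have h2 : ‖f i‖ ≤ √(∑ t, ‖f i t‖ ^ 2) :=
              (pi_norm_le_iff_of_nonneg (Real.sqrt_nonneg _)).2 fun t =>
                Real.le_sqrt_of_sq_le
                  (Finset.single_le_sum (f := fun t => ‖f i t‖ ^ 2) (fun t _ => by positivity)
                    (Finset.mem_univ t))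
            calc ‖f i‖ ^ 2 ≤ √(∑ t, ‖f i t‖ ^ 2) ^ 2 := by gcongr
              _ = _ := Real.sq_sqrt (by positivity)
          calc ‖v (f i)‖ ^ 2 ≤ (c * ‖f i‖) ^ 2 := by gcongr; exact hv _
            _ ≤ _ := by rw [mul_pow]; gcongr
      _ = c ^ 2 * ∑ t, ∑ i, ‖f i t‖ ^ 2 := by rw [← Finset.mul_sum, Finset.sum_comm]
      _ ≤ c ^ 2 * ∑ _t : ι, (1 : ℝ) := by gcongr with t; exact hf t
      _ = _ := by simp
  set S := sSup V with hS
  have hle : ∀ (n : ℕ) (f : Fin n → ι → 𝕜), (∀ t, ∑ i, ‖f i t‖ ^ 2 ≤ 1) →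
    ∑ i, ‖v (f i)‖ ^ 2 ≤ S := fun n f hf => le_csSup hVb ⟨n, f, hf, rfl⟩
  have hstep : ∀ s ∈ V, s ≤ 24 * c ^ 2 + S / 2 := by
    rintro _ ⟨n, f, hf, rfl⟩
    let g : (Fin n → Bool) → ι → 𝕜 := fun ε => signSum ε f
    -- Level `12` combines with the fourth-moment constant `3` to give remainders of mean square at
    -- most `3 / 12 = 1 / 4`. After `‖a + b‖² ≤ 2‖a‖² + 2‖b‖²` they contribute `S / 2`, which can be
    -- absorbed.
    let T : (Fin n → Bool) → ι → 𝕜 := fun ε t => if ‖g ε t‖ ^ 2 ≤ 12 then g ε t else 0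
    let R : (Fin n → Bool) → ι → 𝕜 := fun ε => g ε - T ε
    have hT : ∀ ε, ‖v (T ε)‖ ^ 2 ≤ 12 * c ^ 2 := fun ε => by
      have h1 : ‖T ε‖ ≤ √12 := (pi_norm_le_iff_of_nonneg (Real.sqrt_nonneg _)).2 fun t => by
        refine Real.le_sqrt_of_sq_le ?_
        simp only [T]
        split_ifs with h
        · exact h
        · simp
      calc ‖v (T ε)‖ ^ 2 ≤ (c * ‖T ε‖) ^ 2 := by gcongr; exact hv _
        _ = c ^ 2 * ‖T ε‖ ^ 2 := mul_pow _ _ _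
        _ ≤ c ^ 2 * √12 ^ 2 := by gcongr
        _ = _ := by rw [Real.sq_sqrt (by norm_num)]; ring
    have hRpt : ∀ ε t, ‖R ε t‖ ^ 2 ≤ ‖g ε t‖ ^ 4 / 12 := fun ε t => by
      simp only [R, T, Pi.sub_apply]
      split_ifs with h
      · simp; positivity
      · rw [sub_zero]; nlinarith [sq_nonneg ‖g ε t‖]
    have hRsum : ∀ t, ∑ ε, ‖R ε t‖ ^ 2 ≤ 2 ^ n / 4 := fun t => by
      calc ∑ ε, ‖R ε t‖ ^ 2 ≤ ∑ ε, ‖g ε t‖ ^ 4 / 12 := Finset.sum_le_sum fun ε _ => hRpt ε t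
        _ = (∑ ε, ‖signSum ε fun i => f i t‖ ^ 4) / 12 := by
            rw [Finset.sum_div]
            simp only [g, signSum_apply]
        _ ≤ (3 * 2 ^ n * (∑ i, ‖f i t‖ ^ 2) ^ 2) / 12 := by
            gcongr
            exact sum_norm_signSum_pow_four_le 𝕜 _
        _ ≤ (3 * 2 ^ n * 1 ^ 2) / 12 := by
            gcongr
            exact hf t
        _ = _ := by ring
    -- The remainders, rescaled by `√(4 / 2 ^ n)`, are again an admissible family, so `S` bounds
    -- them.
    have hRv : ∑ ε, ‖v (R ε)‖ ^ 2 ≤ 2 ^ n / 4 * S := by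
      set a : ℝ := √(4 / 2 ^ n) with ha
      have ha0 : 0 ≤ a := Real.sqrt_nonneg _
      have ha2 : a ^ 2 = 4 / 2 ^ n := Real.sq_sqrt (by positivity)
      have e := Fintype.equivFin (Fin n → Bool)
      have h1 := hle _ (fun k => (a : 𝕜) • R (e.symm k)) fun t => by
        simp only [Pi.smul_apply, norm_smul, RCLike.norm_ofReal, abs_of_nonneg ha0, mul_pow]
        rw [e.symm.sum_comp fun ε => a ^ 2 * ‖R ε t‖ ^ 2, ← Finset.mul_sum, ha2]
        calc 4 / 2 ^ n * ∑ ε, ‖R ε t‖ ^ 2 ≤ 4 / 2 ^ n * (2 ^ n / 4) := by gcongr; exact hRsum t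
          _ = 1 := by field_simp
      simp only [map_smul, norm_smul, RCLike.norm_ofReal, abs_of_nonneg ha0, mul_pow] at h1
      rw [e.symm.sum_comp fun ε => a ^ 2 * ‖v (R ε)‖ ^ 2, ← Finset.mul_sum, ha2] at h1
      calc ∑ ε, ‖v (R ε)‖ ^ 2 = 2 ^ n / 4 * (4 / 2 ^ n * ∑ ε, ‖v (R ε)‖ ^ 2) := by field_simp
        _ ≤ _ := by gcongr
    have h2 : (2 : ℝ) ^ n * ∑ i, ‖v (f i)‖ ^ 2 ≤ 2 ^ n * (24 * c ^ 2 + S / 2) := by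
      calc (2 : ℝ) ^ n * ∑ i, ‖v (f i)‖ ^ 2 = ∑ ε, ‖v (g ε)‖ ^ 2 := by
            rw [← sum_norm_signSum_sq 𝕜]
            simp only [g, map_signSum]
        _ ≤ ∑ ε, (2 * ‖v (T ε)‖ ^ 2 + 2 * ‖v (R ε)‖ ^ 2) := by
            refine Finset.sum_le_sum fun ε _ => ?_
            have h3 : v (g ε) = v (T ε) + v (R ε) := by
              rw [← map_add]; congr 1; simp [R]
            have h4 := norm_add_le (v (T ε)) (v (R ε))
            rw [h3]
            calc ‖v (T ε) + v (R ε)‖ ^ 2 ≤ (‖v (T ε)‖ + ‖v (R ε)‖) ^ 2 := by gcongr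
              _ ≤ _ := by nlinarith [sq_nonneg (‖v (T ε)‖ - ‖v (R ε)‖)]
        _ ≤ ∑ _ε : Fin n → Bool, 2 * (12 * c ^ 2) + 2 * (2 ^ n / 4 * S) := by
            rw [Finset.sum_add_distrib, ← Finset.mul_sum _ _ (2 : ℝ), ← Finset.mul_sum _ _ (2 : ℝ),
              ← Finset.mul_sum _ _ (2 : ℝ)]
            gcongr with ε
            exact hT ε
        _ = _ := by simp; ring
    exact le_of_mul_le_mul_left h2 (by positivity)
  have hSle : S ≤ 24 * c ^ 2 + S / 2 := csSup_le ⟨_, n, f, hf, rfl⟩ hstep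
  linarith [hle n f hf]

/-- The little Grothendieck theorem for `ℓ^∞(ι)`. -/
theorem sum_norm_sq_le_of_pointwise {ι κ : Type*} [Fintype ι] [Fintype κ] (v : (ι → 𝕜) →ₗ[𝕜] H)
    {c : ℝ} (hv : ∀ f, ‖v f‖ ≤ c * ‖f‖) (f : κ → ι → 𝕜) {B : ℝ} (hB : 0 < B)
    (hf : ∀ t, ∑ i, ‖f i t‖ ^ 2 ≤ B) : ∑ i, ‖v (f i)‖ ^ 2 ≤ 48 * c ^ 2 * B := by
  set a : ℝ := √(1 / B) with ha
  have ha0 : 0 ≤ a := Real.sqrt_nonneg _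
  have ha2 : a ^ 2 = 1 / B := Real.sq_sqrt (by positivity)
  have e := Fintype.equivFin κ
  have h1 := sum_norm_sq_le_of_pointwise_one v hv (fun k => (a : 𝕜) • f (e.symm k)) fun t => by
    simp only [Pi.smul_apply, norm_smul, RCLike.norm_ofReal, abs_of_nonneg ha0, mul_pow]
    rw [e.symm.sum_comp fun ε => a ^ 2 * ‖f ε t‖ ^ 2, ← Finset.mul_sum, ha2, one_div_mul_eq_div,
      div_le_one hB]
    exact hf t
  simp only [map_smul, norm_smul, RCLike.norm_ofReal, abs_of_nonneg ha0, mul_pow] at h1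
  rwa [e.symm.sum_comp fun ε => a ^ 2 * ‖v (f ε)‖ ^ 2, ← Finset.mul_sum, ha2, one_div_mul_eq_div,
    div_le_iff₀ hB] at h1

/-- Self-duality of `ℓ²`: test on the conjugate of `z` divided by its norm. -/
theorem sum_norm_sq_le_of_forall_combination {n : ℕ} (z : Fin n → 𝕜) {W : ℝ}
    (h : ∀ a : Fin n → 𝕜, ∑ i, ‖a i‖ ^ 2 ≤ 1 → ‖∑ i, a i * z i‖ ≤ W) :
    ∑ i, ‖z i‖ ^ 2 ≤ W ^ 2 := by
  set N := ∑ i, ‖z i‖ ^ 2 with hN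
  have hN0 : 0 ≤ N := Finset.sum_nonneg fun i _ => by positivity
  rcases hN0.eq_or_lt with h0 | h0
  · rw [← h0]; positivity
  have hs : 0 < √N := Real.sqrt_pos.2 h0
  have h1 := h (fun i => (((√N)⁻¹ : ℝ) : 𝕜) * (starRingEnd 𝕜) (z i)) (by
    simp only [norm_mul, RCLike.norm_ofReal, abs_of_pos (inv_pos.2 hs), mul_pow, RCLike.norm_conj]
    rw [← Finset.mul_sum, inv_pow, Real.sq_sqrt hN0, inv_mul_cancel₀ h0.ne'])
  have h2 : ∑ i, (((√N)⁻¹ : ℝ) : 𝕜) * (starRingEnd 𝕜) (z i) * z i = ((√N : ℝ) : 𝕜) := by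
    simp_rw [mul_assoc, RCLike.conj_mul]
    rw [← Finset.mul_sum]
    have : ∑ i, ((‖z i‖ : ℝ) : 𝕜) ^ 2 = ((N : ℝ) : 𝕜) := by rw [hN]; push_cast; rfl
    rw [this, ← RCLike.ofReal_mul]
    congr 1
    rw [inv_mul_eq_div, Real.div_sqrt]
  rw [h2, RCLike.norm_ofReal, abs_of_pos hs] at h1
  calc N = √N ^ 2 := (Real.sq_sqrt hN0).symm
    _ ≤ W ^ 2 := by gcongr

theorem norm_combination_le_of_weak {X : Type*} [NormedAddCommGroup X] [NormedSpace 𝕜 X] {n : ℕ}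
    (x : Fin n → X) {W : ℝ} (hW0 : 0 ≤ W)
    (hW : ∀ φ : DualBall 𝕜 X, ∑ i, ‖φ.1 (x i)‖ ^ 2 ≤ W ^ 2) (a : Fin n → 𝕜)
    (ha : ∑ i, ‖a i‖ ^ 2 ≤ 1) : ‖∑ i, a i • x i‖ ≤ W := by
  obtain ⟨φ, hφ, h⟩ := exists_dual_vector'' 𝕜 (∑ i, a i • x i)
  have h1 : ‖∑ i, a i • x i‖ = ‖∑ i, a i * φ (x i)‖ := by
    rw [show ∑ i, a i * φ (x i) = φ (∑ i, a i • x i) by simp [map_sum], h]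
    simp
  refine abs_le_of_sq_le_sq' ?_ hW0 |>.2
  rw [h1]
  calc ‖∑ i, a i * φ (x i)‖ ^ 2 ≤ (∑ i, ‖a i‖ * ‖φ (x i)‖) ^ 2 := by
        gcongr
        exact (norm_sum_le _ _).trans_eq (by simp)
    _ ≤ (∑ i, ‖a i‖ ^ 2) * ∑ i, ‖φ (x i)‖ ^ 2 := Finset.sum_mul_sq_le_sq_mul_sq _ _ _
    _ ≤ 1 * W ^ 2 := by gcongr; exact hW ⟨φ, hφ⟩
    _ = _ := one_mul _

/-- Approximation criterion for an operator to be `2`-summing. -/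
theorem mem_summing_two_of_approx {X Y : Type*} [NormedAddCommGroup X] [NormedSpace 𝕜 X]
    [NormedAddCommGroup Y] [NormedSpace 𝕜 Y] (u : X →L[𝕜] Y) {C : ℝ} (hC : 0 ≤ C)
    (h : ∀ (n : ℕ) (x : Fin n → X) (η : ℝ), 0 < η → ∃ x' : Fin n → X, (∀ i, ‖x' i - x i‖ ≤ η) ∧
      ∀ W : ℝ, 0 < W → (∀ a : Fin n → 𝕜, ∑ i, ‖a i‖ ^ 2 ≤ 1 → ‖∑ i, a i • x' i‖ ≤ W) →
        ∑ i, ‖u (x' i)‖ ^ 2 ≤ C * W ^ 2) : u ∈ summing 𝕜 X Y 2 2 := by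
  refine ⟨√C + 1, by positivity, fun n x => ?_⟩
  simp only [Real.rpow_two, ← Real.sqrt_eq_rpow]
  set W := ⨆ φ : DualBall 𝕜 X, √(∑ i, ‖φ.1 (x i)‖ ^ 2) with hW
  have hW0 : 0 ≤ W := Real.iSup_nonneg fun φ => Real.sqrt_nonneg _
  have hb : BddAbove (Set.range fun φ : DualBall 𝕜 X => √(∑ i, ‖φ.1 (x i)‖ ^ 2)) := by
    simp only [Real.sqrt_eq_rpow]
    refine bddAbove_range_sum (by positivity) _ (fun i => ‖x i‖ ^ 2) (fun _ _ => by positivity)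
      fun φ i => ?_
    have := norm_apply_le_of_dualBall φ (x i)
    gcongr
  have hcomb : ∀ a : Fin n → 𝕜, ∑ i, ‖a i‖ ^ 2 ≤ 1 → ‖∑ i, a i • x i‖ ≤ W :=
    norm_combination_le_of_weak x hW0 fun φ => (Real.sqrt_le_left hW0).1 (le_ciSup hb φ)
  set η : ℕ → ℝ := fun k => 1 / ((k : ℝ) + 1) with hη
  have hη0 : ∀ k, 0 < η k := fun k => by positivity
  have hηt : Tendsto η atTop (𝓝 0) := tendsto_one_div_add_atTop_nhds_zero_nat
  choose x' hx' hux' using fun k => h n x (η k) (hη0 k)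
  -- The factor `n` would bound the perturbation; `n + 1` keeps the bound positive even if `W = 0`
  -- and `n = 0`.
  have hle : ∀ k, ∑ i, ‖u (x' k i)‖ ^ 2 ≤ C * (W + (n + 1) * η k) ^ 2 := fun k => by
    refine hux' k _ (by have := hη0 k; positivity) fun a ha => ?_
    have h1 : ∀ i, ‖a i • (x' k i - x i)‖ ≤ η k := fun i => by
      have h2 : ‖a i‖ ^ 2 ≤ 1 :=
        (Finset.single_le_sum (f := fun i => ‖a i‖ ^ 2) (fun i _ => by positivity)
          (Finset.mem_univ i)).trans ha
      have h3 : ‖a i‖ ≤ 1 := by nlinarith [norm_nonneg (a i)]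
      rw [norm_smul]
      calc _ ≤ 1 * η k := mul_le_mul h3 (hx' k i) (norm_nonneg _) zero_le_one
        _ = _ := one_mul _
    calc ‖∑ i, a i • x' k i‖ = ‖∑ i, a i • x i + ∑ i, a i • (x' k i - x i)‖ := by
          rw [← Finset.sum_add_distrib]; simp [← smul_add]
      _ ≤ W + ∑ _i : Fin n, η k := by
          refine (norm_add_le _ _).trans (add_le_add (hcomb a ha) ?_)
          exact (norm_sum_le _ _).trans (Finset.sum_le_sum fun i _ => h1 i)
      _ ≤ _ := by simp; linarith [hη0 k]
  have hxt : ∀ i, Tendsto (fun k => x' k i) atTop (𝓝 (x i)) := fun i =>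
    tendsto_iff_norm_sub_tendsto_zero.2
      (squeeze_zero (fun _ => norm_nonneg _) (fun k => hx' k i) hηt)
  have hlim : Tendsto (fun k => ∑ i, ‖u (x' k i)‖ ^ 2) atTop (𝓝 (∑ i, ‖u (x i)‖ ^ 2)) :=
    tendsto_finsetSum _ fun i _ => (((u.continuous.tendsto _).comp (hxt i)).norm).pow 2
  have hlim' : Tendsto (fun k => C * (W + (n + 1) * η k) ^ 2) atTop (𝓝 (C * W ^ 2)) := by
    have := (((hηt.const_mul ((n : ℝ) + 1)).const_add W).pow 2).const_mul C
    simpa using this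
  have hfin := le_of_tendsto_of_tendsto' hlim hlim' hle
  calc √(∑ i, ‖u (x i)‖ ^ 2) ≤ √(C * W ^ 2) := Real.sqrt_le_sqrt hfin
    _ = √C * W := by rw [Real.sqrt_mul hC, Real.sqrt_sq hW0]
    _ ≤ (√C + 1) * W := by gcongr; linarith

end LittleGrothendieck

end AbsContOp

namespace AbsContOp

/-! ### Operators from `L^∞` and `L^1` into a Hilbert space. -/

section Lebesgue

variable {𝕜 : Type*} [RCLike 𝕜]
variable {H : Type*} [NormedAddCommGroup H] [InnerProductSpace 𝕜 H]
variable {Λ : Type*} [MeasurableSpace Λ] {ν : Measure Λ}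

theorem norm_le_of_ae_bound_top (f : Lp 𝕜 ∞ ν) {M : ℝ} (hM : 0 ≤ M) (h : ∀ᵐ t ∂ν, ‖f t‖ ≤ M) :
    ‖f‖ ≤ M := by
  rw [Lp.norm_def, eLpNorm_exponent_top]
  exact ENNReal.toReal_le_of_le_ofReal hM (eLpNormEssSup_le_of_ae_bound h)

theorem ae_norm_le_norm_top (f : Lp 𝕜 ∞ ν) : ∀ᵐ t ∂ν, ‖f t‖ ≤ ‖f‖ := by
  filter_upwards [enorm_ae_le_eLpNormEssSup f ν] with t ht
  rw [Lp.norm_def, eLpNorm_exponent_top]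
  rw [← toReal_enorm]
  exact ENNReal.toReal_mono (by rw [← eLpNorm_exponent_top]; exact Lp.eLpNorm_ne_top f) ht

/-- The `i`-th coordinate of a simple function with values in `𝕜ⁿ`, in `L^∞`. -/
def coordTop {n : ℕ} (ν : Measure Λ) (G : SimpleFunc Λ (Fin n → 𝕜)) (i : Fin n) : Lp 𝕜 ∞ ν :=
  ((G.map fun c => c i).memLp_top ν).toLp _

theorem coordTop_ae {n : ℕ} (G : SimpleFunc Λ (Fin n → 𝕜)) :
    ∀ᵐ t ∂ν, ∀ i, coordTop ν G i t = G t i :=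
  ae_all_iff.2 fun i => MemLp.coeFn_toLp ((G.map fun c : Fin n → 𝕜 => c i).memLp_top ν)

/-- The joint map into `𝕜ⁿ` lies almost everywhere in a compact ball; project it to the nearest
point of a finite `η`-net. One simple function thus approximates all coordinates. -/
theorem exists_simpleFunc_top {n : ℕ} (x : Fin n → Lp 𝕜 ∞ ν) {η : ℝ} (hη : 0 < η) :
    ∃ G : SimpleFunc Λ (Fin n → 𝕜), ∀ i, ‖coordTop ν G i - x i‖ ≤ η := by
  set F : Λ → Fin n → 𝕜 := fun t i => x i t with hF
  have hFm : Measurable F := measurable_pi_iff.2 fun i => (Lp.stronglyMeasurable (x i)).measurable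
  set R : ℝ := ∑ i, ‖x i‖ with hR
  have hFR : ∀ᵐ t ∂ν, F t ∈ Metric.closedBall (0 : Fin n → 𝕜) R := by
    filter_upwards [ae_all_iff.2 fun i => ae_norm_le_norm_top (x i)] with t ht
    rw [mem_closedBall_zero_iff, pi_norm_le_iff_of_nonneg (by positivity)]
    exact fun i => (ht i).trans
      (Finset.single_le_sum (f := fun i => ‖x i‖) (fun _ _ => norm_nonneg _) (Finset.mem_univ i))
  set e := TopologicalSpace.denseSeq (Fin n → 𝕜) with he
  obtain ⟨T, hT⟩ := (isCompact_closedBall (0 : Fin n → 𝕜) R).elim_finite_subcover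
    (fun k => Metric.ball (e k) η) (fun _ => Metric.isOpen_ball) fun y _ => by
      obtain ⟨k, hk⟩ := (TopologicalSpace.denseRange_denseSeq (Fin n → 𝕜)).exists_dist_lt y hη
      exact Set.mem_iUnion.2 ⟨k, hk⟩
  refine ⟨(SimpleFunc.nearestPt e (T.sup id)).comp F hFm, fun i =>
    norm_le_of_ae_bound_top _ hη.le ?_⟩
  filter_upwards [hFR, coordTop_ae (ν := ν) ((SimpleFunc.nearestPt e (T.sup id)).comp F hFm),
    Lp.coeFn_sub (coordTop ν ((SimpleFunc.nearestPt e (T.sup id)).comp F hFm) i) (x i)]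
    with t h1 h2 h3
  obtain ⟨k, hk, hkt⟩ := Set.mem_iUnion₂.1 (hT h1)
  have h4 := SimpleFunc.edist_nearestPt_le e (F t) (Finset.le_sup (f := id) hk)
  have h5 : dist (SimpleFunc.nearestPt e (T.sup id) (F t)) (F t) ≤ η := by
    rw [edist_dist, edist_dist, ENNReal.ofReal_le_ofReal_iff dist_nonneg] at h4
    exact h4.trans (by rw [dist_comm]; exact (Metric.mem_ball.1 hkt).le)
  rw [h3, Pi.sub_apply, h2 i]
  exact (dist_eq_norm _ _).symm.le.trans ((dist_le_pi_dist _ _ i).trans h5)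

theorem sum_coordTop_ae {n : ℕ} (G : SimpleFunc Λ (Fin n → 𝕜)) (a : Fin n → 𝕜) :
    ∀ᵐ t ∂ν, (∑ i, a i • coordTop ν G i : Lp 𝕜 ∞ ν) t = ∑ i, a i * G t i := by
  filter_upwards [coordTop_ae (ν := ν) G,
    Lp.coeFn_finsetSum Finset.univ fun i => a i • coordTop ν G i,
    ae_all_iff.2 fun i => Lp.coeFn_smul (a i) (coordTop ν G i)] with t h1 h2 h3
  rw [h2]
  simp only [Finset.sum_apply]
  refine Finset.sum_congr rfl fun i _ => ?_
  rw [h3, Pi.smul_apply, h1, smul_eq_mul]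

/-- The coordinates of `G` lie in the image of a finite `ℓ^∞(S)` under a contraction `J`, so the
finite theorem applies to `u ∘ J`. -/
theorem sum_norm_sq_coordTop_le (u : Lp 𝕜 ∞ ν →L[𝕜] H) {n : ℕ} (G : SimpleFunc Λ (Fin n → 𝕜))
    {W : ℝ} (hW : 0 < W)
    (h : ∀ a : Fin n → 𝕜, ∑ i, ‖a i‖ ^ 2 ≤ 1 → ‖∑ i, a i • coordTop ν G i‖ ≤ W) :
    ∑ i, ‖u (coordTop ν G i)‖ ^ 2 ≤ 48 * ‖u‖ ^ 2 * W ^ 2 := by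
  classical
  -- Values on null sets are dropped, because the essential supremum in the hypothesis says nothing
  -- about them.
  set S := G.range.filter fun c => ν (G ⁻¹' {c}) ≠ 0 with hS
  have hae : ∀ᵐ t ∂ν, G t ∈ S := by
    have : ∀ c ∈ G.range, ∀ᵐ t ∂ν, c ∉ S → G t ≠ c := fun c hc => by
      by_cases h0 : ν (G ⁻¹' {c}) = 0
      · filter_upwards [measure_eq_zero_iff_ae_notMem.1 h0] with t ht _ using ht
      · exact Eventually.of_forall fun t hcS => absurd (Finset.mem_filter.2 ⟨hc, h0⟩) hcS
    filter_upwards [(Finset.eventually_all _).2 this] with t ht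
    by_contra hcon
    exact ht _ (G.mem_range_self t) hcon rfl
  let E : (S → 𝕜) → (Fin n → 𝕜) → 𝕜 := fun b c => if hc : c ∈ S then b ⟨c, hc⟩ else 0
  let J : (S → 𝕜) →ₗ[𝕜] Lp 𝕜 ∞ ν :=
    { toFun := fun b => ((G.map (E b)).memLp_top ν).toLp _
      map_add' := fun b b' => by
        rw [← MemLp.toLp_add]
        congr 1
        ext t
        simp only [SimpleFunc.coe_map, Function.comp_apply, Pi.add_apply, E]
        split_ifs <;> simp
      map_smul' := fun a b => by
        rw [RingHom.id_apply, ← MemLp.toLp_const_smul]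
        congr 1
        ext t
        simp only [SimpleFunc.coe_map, Function.comp_apply, Pi.smul_apply, E]
        split_ifs <;> simp }
  have hJae : ∀ b, J b =ᵐ[ν] fun t => E b (G t) := fun b =>
    MemLp.coeFn_toLp ((G.map (E b)).memLp_top ν)
  have hJ : ∀ b, ‖J b‖ ≤ ‖b‖ := fun b => by
    refine norm_le_of_ae_bound_top _ (norm_nonneg _) ?_
    filter_upwards [hJae b] with t ht
    rw [ht]
    simp only [E]
    split_ifs
    · exact norm_le_pi_norm b _
    · simp
  have hJc : ∀ i, J (fun c => c.1 i) = coordTop ν G i := fun i => by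
    apply Lp.ext
    filter_upwards [hJae fun c => c.1 i, coordTop_ae (ν := ν) G, hae] with t h1 h2 h3
    rw [h1, h2]
    simp only [E, dif_pos h3]
  have hpt : ∀ c : S, ∑ i, ‖c.1 i‖ ^ 2 ≤ W ^ 2 := fun c => by
    refine sum_norm_sq_le_of_forall_combination c.1 fun a ha => ?_
    have hc : ν (G ⁻¹' {c.1}) ≠ 0 := (Finset.mem_filter.1 c.2).2
    have : ∃ᵐ t ∂ν, t ∈ G ⁻¹' {c.1} := by
      rwa [Filter.Frequently, ← measure_eq_zero_iff_ae_notMem]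
    obtain ⟨t, ht, h1, h2⟩ := (this.and_eventually
      ((sum_coordTop_ae (ν := ν) G a).and (ae_norm_le_norm_top (∑ i, a i • coordTop ν G i)))).exists
    rw [h1, show G t = c.1 from ht] at h2
    exact h2.trans (h a ha)
  have := sum_norm_sq_le_of_pointwise (u.toLinearMap ∘ₗ J) (c := ‖u‖)
    (fun f => (u.le_opNorm _).trans (by
      gcongr; exact hJ f)) (fun i c => c.1 i) (by positivity : 0 < W ^ 2) hpt
  simpa only [LinearMap.comp_apply, hJc, ContinuousLinearMap.coe_coe] using this

theorem summing_two_top_eq_univ : summing 𝕜 (Lp 𝕜 ∞ ν) H 2 2 = Set.univ :=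
  Set.eq_univ_of_forall fun u =>
    mem_summing_two_of_approx u (by positivity : 0 ≤ 48 * ‖u‖ ^ 2) fun n x η hη => by
      obtain ⟨G, hG⟩ := exists_simpleFunc_top x hη
      exact ⟨coordTop ν G, hG, fun W hW h => sum_norm_sq_coordTop_le u G hW h⟩

/-- The little Grothendieck theorem, transposed: a family `h` in a Hilbert space gives an operator
on `ℓ^1(S)` that is `2`-summing. -/
theorem sum_norm_sq_combination_le {S : Type*} [Fintype S] {n : ℕ} (c : S → Fin n → 𝕜) (m : S → ℝ)
    (hm : ∀ s, 0 ≤ m s) {W : ℝ} (hW0 : 0 ≤ W)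
    (hW : ∀ a : Fin n → 𝕜, ∑ i, ‖a i‖ ^ 2 ≤ 1 → ∑ s, m s * ‖∑ i, a i * c s i‖ ≤ W)
    (h : S → H) {B : ℝ} (hB : 0 < B) (hh : ∀ s, ‖h s‖ ≤ B * m s) :
    ∑ i, ‖∑ s, c s i • h s‖ ^ 2 ≤ 48 * W ^ 2 * B ^ 2 := by
  -- Passing to the span provides a finite orthonormal basis, although `H` may be
  -- infinite-dimensional.
  let E := Submodule.span 𝕜 (Set.range h)
  have : FiniteDimensional 𝕜 E := FiniteDimensional.span_of_finite 𝕜 (Set.finite_range h)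
  let e := stdOrthonormalBasis 𝕜 E
  let h' : S → E := fun s => ⟨h s, Submodule.subset_span ⟨s, rfl⟩⟩
  -- The transposed map: the hypothesis `hW` says exactly what is needed for its norm to be at most
  -- `W`.
  let v : (S → 𝕜) →ₗ[𝕜] EuclideanSpace 𝕜 (Fin n) :=
    { toFun := fun f => WithLp.toLp 2 fun i => ∑ s, f s * ((m s : 𝕜) * c s i)
      map_add' := fun f g => by
        ext i
        simp [add_mul, Finset.sum_add_distrib]
      map_smul' := fun a f => by
        ext i
        simp [Finset.mul_sum, mul_assoc] }
  have hvi : ∀ f i, v f i = ∑ s, f s * ((m s : 𝕜) * c s i) := fun f i => rfl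
  have hv : ∀ f, ‖v f‖ ≤ W * ‖f‖ := fun f => by
    have h1 : ∑ i, ‖v f i‖ ^ 2 ≤ (W * ‖f‖) ^ 2 := by
      refine sum_norm_sq_le_of_forall_combination _ fun a ha => ?_
      have h2 : ∑ i, a i * v f i = ∑ s, f s * ((m s : 𝕜) * ∑ i, a i * c s i) := by
        simp only [hvi, Finset.mul_sum]
        rw [Finset.sum_comm]
        refine Finset.sum_congr rfl fun s _ => Finset.sum_congr rfl fun i _ => by ring
      rw [h2]
      calc _ ≤ ∑ s, ‖f‖ * (m s * ‖∑ i, a i * c s i‖) := by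
            refine (norm_sum_le _ _).trans (Finset.sum_le_sum fun s _ => ?_)
            rw [norm_mul, norm_mul, RCLike.norm_ofReal, abs_of_nonneg (hm s)]
            have := hm s
            gcongr
            exact norm_le_pi_norm f s
        _ ≤ ‖f‖ * W := by rw [← Finset.mul_sum]; gcongr; exact hW a ha
        _ = _ := mul_comm _ _
    rw [EuclideanSpace.norm_eq]
    exact (Real.sqrt_le_left (by positivity)).2 h1
  -- For the functions `f_k(s) = m(s)⁻¹ ⟨e k, h s⟩`, Parseval gives `∑ |f_k(s)|² = ‖h s‖² / m(s)² ≤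
  -- B²` when `m s > 0`. Summing the coordinates of `v f_k` over `k` before `i` or after gives the
  -- two sides of a Hilbert–Schmidt identity.
  have key := sum_norm_sq_le_of_pointwise v hv
    (fun k s => (((m s)⁻¹ : ℝ) : 𝕜) * inner 𝕜 (e k) (h' s)) (by positivity : 0 < B ^ 2) fun s => by
      simp only [norm_mul, mul_pow, RCLike.norm_ofReal, sq_abs]
      rw [← Finset.mul_sum, e.sum_sq_norm_inner_right]
      have h1 : ‖h' s‖ ≤ B * m s := hh s
      rcases (hm s).eq_or_lt with h0 | h0
      · rw [← h0]; simp; positivity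
      · rw [inv_pow, inv_mul_le_iff₀ (by positivity)]
        calc ‖h' s‖ ^ 2 ≤ (B * m s) ^ 2 := by gcongr
          _ = _ := by ring
  refine le_trans (le_of_eq ?_) key
  have hcoord : ∀ k i, v (fun s => (((m s)⁻¹ : ℝ) : 𝕜) * inner 𝕜 (e k) (h' s)) i =
      inner 𝕜 (e k) (∑ s, c s i • h' s) := fun k i => by
    rw [hvi, inner_sum]
    refine Finset.sum_congr rfl fun s _ => ?_
    rw [inner_smul_right]
    -- Where `m s = 0` the vector `h s` vanishes, so the convention `0⁻¹ = 0` is harmless.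
    rcases (hm s).eq_or_lt with h0 | h0
    · have : h' s = 0 := by
        apply Subtype.ext
        have := hh s
        rw [← h0, mul_zero] at this
        exact norm_le_zero_iff.1 this
      rw [this, inner_zero_right]; ring
    · have : (m s : 𝕜) ≠ 0 := by exact_mod_cast h0.ne'
      rw [RCLike.ofReal_inv]
      field_simp
  simp_rw [EuclideanSpace.norm_sq_eq, hcoord]
  rw [Finset.sum_comm]
  refine Finset.sum_congr rfl fun i _ => ?_
  have hcoe : ((∑ s, c s i • h' s : E) : H) = ∑ s, c s i • h s := by simp [h']
  rw [e.sum_sq_norm_inner_right, ← hcoe]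
  rfl

/-- The `i`-th coordinate of a simple function with values in `𝕜ⁿ`, in `L^1`. -/
def coordOne {n : ℕ} {G : SimpleFunc Λ (Fin n → 𝕜)} (hG : MemLp G 1 ν) (i : Fin n) : Lp 𝕜 1 ν :=
  (hG.eval i).toLp _

theorem coordOne_ae {n : ℕ} {G : SimpleFunc Λ (Fin n → 𝕜)} (hG : MemLp G 1 ν) :
    ∀ᵐ t ∂ν, ∀ i, coordOne hG i t = G t i :=
  ae_all_iff.2 fun i => MemLp.coeFn_toLp (hG.eval i)

theorem exists_simpleFunc_one {n : ℕ} (x : Fin n → Lp 𝕜 1 ν) {η : ℝ} (hη : 0 < η) :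
    ∃ (G : SimpleFunc Λ (Fin n → 𝕜)) (hG : MemLp G 1 ν), ∀ i, ‖coordOne hG i - x i‖ ≤ η := by
  have hF : MemLp (fun t i => x i t : Λ → Fin n → 𝕜) 1 ν := MemLp.of_eval fun i => Lp.memLp (x i)
  obtain ⟨G, hG, hG1⟩ := hF.exists_simpleFunc_eLpNorm_sub_lt ENNReal.one_ne_top
    (ENNReal.ofReal_pos.2 hη).ne'
  refine ⟨G, hG1, fun i => ?_⟩
  rw [Lp.norm_def]
  refine ENNReal.toReal_le_of_le_ofReal hη.le (le_trans ?_ hG.le)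
  refine eLpNorm_mono_ae ?_
  filter_upwards [coordOne_ae hG1, Lp.coeFn_sub (coordOne hG1 i) (x i)] with t h1 h2
  rw [h2, Pi.sub_apply, h1, norm_sub_rev]
  exact norm_le_pi_norm ((fun i => x i t) - G t) i

theorem sum_coordOne_ae {n : ℕ} {G : SimpleFunc Λ (Fin n → 𝕜)} (hG : MemLp G 1 ν)
    (a : Fin n → 𝕜) : ∀ᵐ t ∂ν, (∑ i, a i • coordOne hG i : Lp 𝕜 1 ν) t = ∑ i, a i * G t i := by
  filter_upwards [coordOne_ae hG, Lp.coeFn_finsetSum Finset.univ fun i => a i • coordOne hG i,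
    ae_all_iff.2 fun i => Lp.coeFn_smul (a i) (coordOne hG i)] with t h1 h2 h3
  rw [h2]
  simp only [Finset.sum_apply]
  refine Finset.sum_congr rfl fun i _ => ?_
  rw [h3, Pi.smul_apply, h1, smul_eq_mul]

/-- Expand the coordinates in indicators `χ c` of the level sets: the `L^1` norm is a weighted `ℓ^1`
norm, and `‖u (χ c)‖` is at most `‖u‖` times the weight. -/
theorem sum_norm_sq_coordOne_le (u : Lp 𝕜 1 ν →L[𝕜] H) {n : ℕ} {G : SimpleFunc Λ (Fin n → 𝕜)}
    (hG : MemLp G 1 ν) {W : ℝ} (hW : 0 < W)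
    (h : ∀ a : Fin n → 𝕜, ∑ i, ‖a i‖ ^ 2 ≤ 1 → ‖∑ i, a i • coordOne hG i‖ ≤ W) :
    ∑ i, ‖u (coordOne hG i)‖ ^ 2 ≤ 48 * (‖u‖ + 1) ^ 2 * W ^ 2 := by
  classical
  -- The fibre over `0` may have infinite measure; all others have finite measure by integrability.
  set S := G.range.filter fun c => c ≠ 0 with hS
  have hfin : ∀ c : S, ν (G ⁻¹' {c.1}) ≠ ∞ := fun c =>
    (SimpleFunc.measure_preimage_lt_top_of_memLp one_ne_zero ENNReal.one_ne_top G hG c.1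
      (Finset.mem_filter.1 c.2).2).ne
  let χ : S → Lp 𝕜 1 ν := fun c => indicatorConstLp 1 (G.measurableSet_fiber c.1) (hfin c) 1
  have hχ : ∀ i, coordOne hG i = ∑ c : S, c.1 i • χ c := fun i => by
    apply Lp.ext
    filter_upwards [coordOne_ae hG, Lp.coeFn_finsetSum Finset.univ fun c : S => c.1 i • χ c,
      ae_all_iff.2 fun c : S => Lp.coeFn_smul (c.1 i) (χ c),
      ae_all_iff.2 fun c : S => indicatorConstLp_coeFn (p := 1) (c := (1 : 𝕜))
        (hs := G.measurableSet_fiber c.1) (hμs := hfin c)] with t h1 h2 h3 h4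
    rw [h1, h2]
    simp only [Finset.sum_apply]
    have h5 : ∀ c : S, (c.1 i • χ c : Lp 𝕜 1 ν) t = if c.1 = G t then c.1 i else 0 := fun c => by
      rw [h3, Pi.smul_apply, h4]
      by_cases hc : c.1 = G t
      · rw [Set.indicator_of_mem (by simp [hc]), if_pos hc, smul_eq_mul, mul_one]
      · rw [Set.indicator_of_notMem (by simpa using fun h => hc h.symm), if_neg hc, smul_zero]
    simp_rw [h5]
    by_cases h0 : G t = 0
    · rw [Finset.sum_eq_zero fun (c : S) _ =>
        if_neg fun hc => (Finset.mem_filter.1 c.2).2 (hc.trans h0),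
        h0]
      rfl
    · have hmem : G t ∈ S := Finset.mem_filter.2 ⟨G.mem_range_self t, h0⟩
      rw [Finset.sum_eq_single ⟨G t, hmem⟩ (fun c _ hc => if_neg fun h => hc (Subtype.ext h))
        (by simp), if_pos rfl]
  have hnorm : ∀ a : Fin n → 𝕜, ‖∑ i, a i • coordOne hG i‖ =
      ∑ c : S, ν.real (G ⁻¹' {c.1}) * ‖∑ i, a i * c.1 i‖ := fun a => by
    rw [L1.norm_eq_integral_norm]
    have h1 : ∫ t, ‖(∑ i, a i • coordOne hG i : Lp 𝕜 1 ν) t‖ ∂ν = ∫ t, ‖∑ i, a i * G t i‖ ∂ν := by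
      refine integral_congr_ae ?_
      filter_upwards [sum_coordOne_ae hG a] with t ht
      rw [ht]
    have hGi := memLp_one_iff_integrable.1 hG
    have h2 : Integrable (G.map fun c => ‖∑ i, a i * c i‖) ν :=
      (integrable_finsetSum _ fun i _ => (hGi.eval i).const_mul (a i)).norm
    have h3 : ∫ t, ‖∑ i, a i * G t i‖ ∂ν =
        ∑ c ∈ G.range, ν.real (G ⁻¹' {c}) * ‖∑ i, a i * c i‖ := by
      rw [show ∑ c ∈ G.range, ν.real (G ⁻¹' {c}) * ‖∑ i, a i * c i‖ =
        SimpleFunc.integral ν (G.map fun c => ‖∑ i, a i * c i‖) from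
        (SimpleFunc.map_integral G (fun c => ‖∑ i, a i * c i‖) hGi (by simp)).symm,
        SimpleFunc.integral_eq_integral _ h2]
      rfl
    rw [h1, h3, Finset.sum_coe_sort S fun c => ν.real (G ⁻¹' {c}) * ‖∑ i, a i * c i‖, hS,
      Finset.sum_filter_of_ne]
    rintro c _ hc rfl
    simp at hc
  have key := sum_norm_sq_combination_le (fun (c : S) i => c.1 i)
    (fun c => ν.real (G ⁻¹' {c.1})) (fun _ => measureReal_nonneg) hW.le
    (fun a ha => (hnorm a).symm.le.trans (h a ha)) (fun c => u (χ c))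
    (by positivity : 0 < ‖u‖ + 1) fun c => by
      have h1 : ‖χ c‖ = ν.real (G ⁻¹' {c.1}) := by
        rw [norm_indicatorConstLp one_ne_zero ENNReal.one_ne_top]; simp
      calc ‖u (χ c)‖ ≤ ‖u‖ * ‖χ c‖ := u.le_opNorm _
        _ ≤ (‖u‖ + 1) * ν.real (G ⁻¹' {c.1}) := by rw [h1]; gcongr; linarith
  simp only [hχ, map_sum, map_smul]
  linarith

theorem summing_two_one_eq_univ : summing 𝕜 (Lp 𝕜 1 ν) H 2 2 = Set.univ :=
  Set.eq_univ_of_forall fun u =>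
    mem_summing_two_of_approx u (by positivity : 0 ≤ 48 * (‖u‖ + 1) ^ 2) fun n x η hη => by
      obtain ⟨G, hG, hGx⟩ := exists_simpleFunc_one x hη
      exact ⟨coordOne hG, hGx, fun W hW h => sum_norm_sq_coordOne_le u hG hW h⟩

end Lebesgue

end AbsContOp

namespace AbsContOp

/-! ### Assembly. -/

theorem compContinuous_and_absCont_eq_univ {𝕜 : Type*} [RCLike 𝕜]
    {X : Type*} [NormedAddCommGroup X] [NormedSpace 𝕜 X]
    {Y : Type*} [NormedAddCommGroup Y] [NormedSpace 𝕜 Y] [CompleteSpace Y]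
    {Ω : Type*} [MeasurableSpace Ω] {μ : Measure Ω} [IsFiniteMeasure μ]
    {σ : ℝ} (hσ₀ : 0 ≤ σ) (hσ₁ : σ < 1) {s : ℝ} (hs : 1 ≤ s) (hsr : s ≤ 1 / (1 - σ))
    (h : summing 𝕜 X Y s s = Set.univ) :
    (∀ u : X →L[𝕜] Y, CompContinuous (1 / (1 - σ)) σ μ u) ∧
      ∀ p q : ℝ, 1 ≤ p → p ≤ q → absCont 𝕜 X Y σ q p = Set.univ := by
  have key : ∀ u : X →L[𝕜] Y, ∃ D, 0 ≤ D ∧ DominatedWith (1 / (1 - σ)) D u := fun u =>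
    exists_dominatedWith_of_mem_summing hs hsr (h ▸ Set.mem_univ u)
  refine ⟨fun u => ?_, fun p q hp hpq => Set.eq_univ_of_forall fun u => ?_⟩
  · obtain ⟨D, hD, hu⟩ := key u
    exact hu.compContinuous hσ₀ hσ₁ hD
  · obtain ⟨D, hD, hu⟩ := key u
    exact hu.mem_absCont hσ₁ hD hp hpq

end AbsContOp

end

theorem corollary5p1 {𝕜 : Type*} [RCLike 𝕜]
    {X : Type*} [NormedAddCommGroup X] [NormedSpace 𝕜 X] [CompleteSpace X]
    {Y : Type*} [NormedAddCommGroup Y] [NormedSpace 𝕜 Y] [CompleteSpace Y]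
    {H : Type*} [NormedAddCommGroup H] [InnerProductSpace 𝕜 H] [CompleteSpace H]
    {K : Type*} [TopologicalSpace K] [CompactSpace K] [T2Space K]
    {Λ : Type*} [MeasurableSpace Λ] (ν : Measure Λ)
    {Ω : Type*} [MeasurableSpace Ω] (μ : Measure Ω) [IsFiniteMeasure μ]
    (hμ : AbsContOp.NonAtomic μ)
    (σ : ℝ) (hσ₀ : 0 ≤ σ) (hσ₁ : σ < 1) :
    -- (i)
    (μ ≠ 0 → ∀ u : X →L[𝕜] Y, AbsContOp.CompContinuous (1 / (1 - σ)) σ μ u →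
      ∀ p q : ℝ, 1 ≤ p → p ≤ q → u ∈ AbsContOp.absCont 𝕜 X Y σ q p) ∧
    -- (ii)
    (AbsContOp.summing 𝕜 X Y (1 / (1 - σ)) 1 = AbsContOp.absCont₁ 𝕜 X Y σ 1 →
      ∀ p q : ℝ, 1 ≤ p → p ≤ q →
        AbsContOp.summing 𝕜 X Y (1 / (1 - σ)) 1 ⊆ AbsContOp.absCont 𝕜 X Y σ q p) ∧
    (∀ p q : ℝ, 1 ≤ p → p ≤ q →
      AbsContOp.summing 𝕜 C(K, 𝕜) Y (1 / (1 - σ)) 1 ⊆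
        AbsContOp.absCont 𝕜 C(K, 𝕜) Y σ q p) ∧
    -- (iii)
    (∀ s : ℝ, 1 ≤ s → s ≤ 1 / (1 - σ) → AbsContOp.summing 𝕜 X Y s s = Set.univ →
      (∀ u : X →L[𝕜] Y, AbsContOp.CompContinuous (1 / (1 - σ)) σ μ u) ∧
      ∀ p q : ℝ, 1 ≤ p → p ≤ q → AbsContOp.absCont 𝕜 X Y σ q p = Set.univ) ∧
    -- the instances of (iii), with `s = 2`
    (1 / 2 ≤ σ →
      (AbsContOp.summing 𝕜 (Lp 𝕜 ∞ ν) H 2 2 = Set.univ ∧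
        (∀ u : Lp 𝕜 ∞ ν →L[𝕜] H, AbsContOp.CompContinuous (1 / (1 - σ)) σ μ u) ∧
        ∀ p q : ℝ, 1 ≤ p → p ≤ q →
          AbsContOp.absCont 𝕜 (Lp 𝕜 ∞ ν) H σ q p = Set.univ) ∧
      (AbsContOp.summing 𝕜 (Lp 𝕜 1 ν) H 2 2 = Set.univ ∧
        (∀ u : Lp 𝕜 1 ν →L[𝕜] H, AbsContOp.CompContinuous (1 / (1 - σ)) σ μ u) ∧
        ∀ p q : ℝ, 1 ≤ p → p ≤ q →
          AbsContOp.absCont 𝕜 (Lp 𝕜 1 ν) H σ q p = Set.univ)) := by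
  have h1 : 0 < 1 - σ := by linarith
  have hr : 1 ≤ 1 / (1 - σ) := by rw [le_div_iff₀ h1]; linarith
  refine ⟨fun hμ0 u hu p q hp hpq => ?_, fun h p q hp hpq u hu => ?_, fun p q hp hpq u hu => ?_,
    fun s hs hsr h => ?_, fun hσ => ?_⟩
  · obtain ⟨D, hD, hu'⟩ := AbsContOp.exists_dominatedWith_of_compContinuous hμ hμ0 hσ₀ hσ₁ hu
    exact hu'.mem_absCont hσ₁ hD hp hpq
  · rw [h] at hu
    obtain ⟨D, hD, hu'⟩ := AbsContOp.exists_dominatedWith_of_mem_absCont₁ hσ₁ hu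
    exact hu'.mem_absCont hσ₁ hD hp hpq
  · obtain ⟨D, hD, hu'⟩ := AbsContOp.exists_dominatedWith_of_mem_summing_one hr hu
    exact hu'.mem_absCont hσ₁ hD hp hpq
  · exact AbsContOp.compContinuous_and_absCont_eq_univ hσ₀ hσ₁ hs hsr h
  · have h2 : (2 : ℝ) ≤ 1 / (1 - σ) := by rw [le_div_iff₀ h1]; linarith
    exact ⟨⟨AbsContOp.summing_two_top_eq_univ, AbsContOp.compContinuous_and_absCont_eq_univ hσ₀ hσ₁
      one_le_two h2 AbsContOp.summing_two_top_eq_univ⟩,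
      AbsContOp.summing_two_one_eq_univ, AbsContOp.compContinuous_and_absCont_eq_univ hσ₀ hσ₁
      one_le_two h2 AbsContOp.summing_two_one_eq_univ⟩
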